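/- All representations are on complex vector spaces. A representation of a topological group is smooth if every vector has an open stabilizer, and admissible if moreover every open subgroup has a finite-dimensional space of fixed vectors. $\operatorname{Irr}(G)$ denotes the set of isomorphism classes of irreducible smooth representations of $G$, and $\mathcal R_G(\rho)=\{\pi\in\operatorname{Irr}(G) : \operatorname{Hom}_G(\rho,\pi)\neq 0\}$ for a representation $\rho$ of $G$. A smooth representation $\rho$ of $A\times B$ is a strong bigraph representation if the two projections $\sigma\otimes\delta\mapsto\sigma$ and $\sigma\otimes\delta\mapsto\delta$ are injective on $\mathcal R_{A\times B}(\rho)$ and $\dim\operatorname{Hom}_{A\times B}(\rho,\tau)\le 1$ for every $\tau\in\operatorname{Irr}(A\times B)$. **Proposition.** Let $G_1,G_2$ be locally compact totally disconnected groups and, for $i=1,2$, let $H_i$ be a closed normal subgroup of $G_i$ with $G_i/H_i$ solvable. Suppose that all irreducible smooth representations of $G_i$ and of $H_i$ are admissible, and that $\pi|_{H_i}$ is admissible for every $\pi\in\operatorname{Irr}(G_i)$. Let $\Gamma$ be a closed normal subgroup of $G_1\times G_2$ containing $H_1\times H_2$ such that $\Gamma/(H_1\times H_2)$ is the graph of a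 bijective homomorphism $\gamma:G_1/H_1\to G_2/H_2$. Let $\rho$ be a smooth representation of $\Gamma$ whose restriction to $H_1\times H_2$ is a strong bigraph representation, and let $\pi=c\text{-}\operatorname{Ind}_\Gamma^{G_1\times G_2}\rho$ be the compactly induced representation (unnormalized). Let $\pi_1\in\operatorname{Irr}(G_1)$, $\pi_2\in\operatorname{Irr}(G_2)$ be such that $$\pi_1|_{H_1}\simeq\bigoplus_{\sigma\in\mathcal R_{H_1}(\pi_1)}m_1\,\sigma,\qquad \pi_2|_{H_2}\simeq\bigoplus_{\delta\in\mathcal R_{H_2}(\pi_2)}m_2\,\delta$$ with natural numbers $m_1,m_2$, and suppose that $\pi_1\otimes\pi_2\in\mathcal R_{G_1\times G_2}(\pi)$. Then: 1. there is a bijection $\theta_\rho:\mathcal R_{H_1}(\pi_1)\to\mathcal R_{H_2}(\pi_2)$ such that, for all $\sigma\in\mathcal R_{H_1}(\pi_1)$ and $\delta\in\mathcal R_{H_2}(\pi_2)$, one has $\sigma\otimes\delta\in\mathcal R_{H_1\times H_2}(\rho)$ if and only if $\delta=\theta_\rho(\sigma)$; 2. $m_1=1$ if and only if $m_2=1$.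 -/

import Mathlib

open scoped TensorProduct

universe u

noncomputable section

/-- A complex representation of a topological group is smooth if every vector has an open
stabilizer. -/
def IsSmoothRep {G V : Type*} [Group G] [TopologicalSpace G] [AddCommGroup V] [Module ℂ V]
    (ρ : Representation ℂ G V) : Prop :=
  ∀ v : V, IsOpen {g : G | ρ g v = v}

/-- The subspace of the vectors fixed by a subgroup `K`. -/
def fixedVectors {G V : Type*} [Group G] [AddCommGroup V] [Module ℂ V]
    (ρ : Representation ℂ G V) (K : Subgroup G) : Submodule ℂ V where
  carrier := {v | ∀ k ∈ K, ρ k v = v}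
  zero_mem' := fun k _ => map_zero (ρ k)
  add_mem' := fun {v w} hv hw k hk => by rw [map_add, hv k hk, hw k hk]
  smul_mem' := fun c v hv k hk => by rw [map_smul, hv k hk]

/-- A representation is admissible if it is smooth and every open subgroup has a
finite-dimensional space of fixed vectors. -/
def IsAdmissibleRep {G V : Type*} [Group G] [TopologicalSpace G] [AddCommGroup V] [Module ℂ V]
    (ρ : Representation ℂ G V) : Prop :=
  IsSmoothRep ρ ∧
    ∀ K : Subgroup G, IsOpen (K : Set G) → FiniteDimensional ℂ (fixedVectors ρ K)

/-- An irreducible smooth complex representation of `G`. Its space is spanned by the translates of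
one vector, so spaces in the universe of `G` give every isomorphism class. -/
structure SmoothIrrep (G : Type u) [Group G] [TopologicalSpace G] where
  V : Type u
  [addCommGroup : AddCommGroup V]
  [module : Module ℂ V]
  rep : Representation ℂ G V
  smooth : IsSmoothRep rep
  irreducible : rep.IsIrreducible

attribute [instance] SmoothIrrep.addCommGroup SmoothIrrep.module

/-- Isomorphism of irreducible smooth representations. -/
instance SmoothIrrep.setoid (G : Type u) [Group G] [TopologicalSpace G] :
    Setoid (SmoothIrrep G) where
  r π π' := Nonempty (π.rep.Equiv π'.rep)
  iseqv :=
    { refl := fun π => ⟨Representation.Equiv.refl π.rep⟩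
      symm := fun ⟨e⟩ => ⟨e.symm⟩
      trans := fun ⟨e⟩ ⟨f⟩ => ⟨e.trans f⟩ }

/-- `Irr(G)`: the isomorphism classes of irreducible smooth representations of `G`. -/
def Irr (G : Type u) [Group G] [TopologicalSpace G] : Type (u + 1) :=
  Quotient (SmoothIrrep.setoid G)

/-- The class of an irreducible smooth representation. -/
def SmoothIrrep.toIrr {G : Type u} [Group G] [TopologicalSpace G] (π : SmoothIrrep G) : Irr G :=
  Quotient.mk _ π

/-- A representation in a given isomorphism class. -/
def Irr.out {G : Type u} [Group G] [TopologicalSpace G] (c : Irr G) : SmoothIrrep G :=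
  Quotient.out c

/-- The quotient set `R_G(ρ)`: the classes `π` in `Irr(G)` with `Hom_G(ρ, π) ≠ 0`. -/
def quotientSet {G : Type u} {V : Type*} [Group G] [TopologicalSpace G] [AddCommGroup V]
    [Module ℂ V] (ρ : Representation ℂ G V) : Set (Irr G) :=
  {c | ∃ π : SmoothIrrep G, π.toIrr = c ∧ ∃ f : Representation.IntertwiningMap ρ π.rep, f ≠ 0}

/-- The external tensor product, a representation of `A × B` on `V ⊗ W`. -/
def extTensor {A B V W : Type*} [Group A] [Group B] [AddCommGroup V] [Module ℂ V]
    [AddCommGroup W] [Module ℂ W] (σ : Representation ℂ A V) (δ : Representation ℂ B W) :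
    Representation ℂ (A × B) (V ⊗[ℂ] W) :=
  Representation.tprod (σ.comp (MonoidHom.fst A B)) (δ.comp (MonoidHom.snd A B))

/-- The class `t` in `Irr(A × B)` is the class of `s ⊗ d`. -/
def IsTensorClass {A B : Type u} [Group A] [TopologicalSpace A] [Group B] [TopologicalSpace B]
    (t : Irr (A × B)) (s : Irr A) (d : Irr B) : Prop :=
  ∃ (τ : SmoothIrrep (A × B)) (σ : SmoothIrrep A) (δ : SmoothIrrep B),
    τ.toIrr = t ∧ σ.toIrr = s ∧ δ.toIrr = d ∧ Nonempty (τ.rep.Equiv (extTensor σ.rep δ.rep))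

/-- `s ⊗ d ∈ R_{A × B}(ρ)`. -/
def TensorMemQuotientSet {A B : Type u} {V : Type*} [Group A] [TopologicalSpace A] [Group B]
    [TopologicalSpace B] [AddCommGroup V] [Module ℂ V] (ρ : Representation ℂ (A × B) V)
    (s : Irr A) (d : Irr B) : Prop :=
  ∃ t ∈ quotientSet ρ, IsTensorClass t s d

/-- A smooth representation of `A × B` is a bigraph (Howe) representation if the two projections
`s ⊗ d ↦ s` and `s ⊗ d ↦ d` are injective on `R_{A × B}(ρ)`; it is a strong one if moreover
`dim Hom(ρ, τ) ≤ 1` for every irreducible smooth `τ`. -/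
structure IsStrongBigraphRep {A B : Type u} {V : Type*} [Group A] [TopologicalSpace A] [Group B]
    [TopologicalSpace B] [AddCommGroup V] [Module ℂ V] (ρ : Representation ℂ (A × B) V) :
    Prop where
  smooth : IsSmoothRep ρ
  fst_injective : ∀ t ∈ quotientSet ρ, ∀ t' ∈ quotientSet ρ, ∀ (s : Irr A) (d d' : Irr B),
    IsTensorClass t s d → IsTensorClass t' s d' → t = t'
  snd_injective : ∀ t ∈ quotientSet ρ, ∀ t' ∈ quotientSet ρ, ∀ (s s' : Irr A) (d : Irr B),
    IsTensorClass t s d → IsTensorClass t' s' d → t = t'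
  multiplicity_free : ∀ τ : SmoothIrrep (A × B),
    Module.rank ℂ (Representation.IntertwiningMap ρ τ.rep) ≤ 1

/-- `π = ⊕_{σ ∈ R_H(π)} m σ`: the representation `π` is isomorphic to the direct sum of `m` copies
of each member of its quotient set. -/
def IsSumWithMultiplicity {H : Type u} {V : Type*} [Group H] [TopologicalSpace H]
    [AddCommGroup V] [Module ℂ V] (π : Representation ℂ H V) (m : ℕ) : Prop :=
  Nonempty (π.Equiv
    (Representation.directSum fun i : quotientSet π × Fin m => (i.1 : Irr H).out.rep))

/-- The space of the compactly induced representation: the functions `f : G → V` with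
`f (γ g) = ρ(γ) f(g)` for `γ` in `Γ`, invariant on the right under some open subgroup, and
supported in `Γ C` for some compact `C`. -/
def cIndSpace {G V : Type*} [Group G] [TopologicalSpace G] [AddCommGroup V] [Module ℂ V]
    (Γ : Subgroup G) (ρ : Representation ℂ Γ V) : Submodule ℂ (G → V) where
  carrier := {f |
    (∀ (γ : Γ) (g : G), f (γ * g) = ρ γ (f g)) ∧
    (∃ K : Subgroup G, IsOpen (K : Set G) ∧ ∀ k ∈ K, ∀ g, f (g * k) = f g) ∧
    (∃ C : Set G, IsCompact C ∧ ∀ g, f g ≠ 0 → ∃ γ : Γ, ∃ c ∈ C, g = γ * c)}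
  zero_mem' := ⟨fun γ _ => (map_zero (ρ γ)).symm, ⟨⊤, isOpen_univ, fun _ _ _ => rfl⟩,
    ⟨∅, isCompact_empty, fun _ h => absurd rfl h⟩⟩
  add_mem' := by
    rintro f f' ⟨h1, ⟨K, hK, h2⟩, C, hC, h3⟩ ⟨h1', ⟨K', hK', h2'⟩, C', hC', h3'⟩
    refine ⟨fun γ g => ?_, ⟨K ⊓ K', hK.inter hK', fun k hk g => ?_⟩, C ∪ C', hC.union hC',
      fun g hg => ?_⟩
    · simp [h1, h1']
    · simp [h2 k hk.1, h2' k hk.2]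
    · by_cases h : f g = 0
      · have h' : f' g ≠ 0 := fun h' => hg (by simp [h, h'])
        obtain ⟨γ, c, hc, e⟩ := h3' g h'
        exact ⟨γ, c, Or.inr hc, e⟩
      · obtain ⟨γ, c, hc, e⟩ := h3 g h
        exact ⟨γ, c, Or.inl hc, e⟩
  smul_mem' := by
    rintro a f ⟨h1, ⟨K, hK, h2⟩, C, hC, h3⟩
    refine ⟨fun γ g => ?_, ⟨K, hK, fun k hk g => ?_⟩, C, hC, fun g hg => h3 g fun h => hg ?_⟩
    · simp [h1]
    · simp [h2 k hk]
    · simp [h]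

theorem cIndSpace_translate {G V : Type*} [Group G] [TopologicalSpace G] [IsTopologicalGroup G]
    [AddCommGroup V] [Module ℂ V] (Γ : Subgroup G) (ρ : Representation ℂ Γ V) (x : G)
    {f : G → V} (hf : f ∈ cIndSpace Γ ρ) : (fun g => f (g * x)) ∈ cIndSpace Γ ρ := by
  obtain ⟨h1, ⟨K, hK, h2⟩, C, hC, h3⟩ := hf
  refine ⟨fun γ g => ?_,
    ⟨K.comap (MulAut.conj x⁻¹).toMonoidHom, ?_, fun k hk g => ?_⟩,
    (fun c => c * x⁻¹) '' C, hC.image (continuous_mul_const x⁻¹), fun g hg => ?_⟩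
  · simp only [mul_assoc]
    exact h1 γ (g * x)
  · have hc : Continuous fun g : G => x⁻¹ * g * x⁻¹⁻¹ := by fun_prop
    exact hK.preimage hc
  · have hk' : x⁻¹ * k * x⁻¹⁻¹ ∈ K := hk
    have := h2 _ hk' (g * x)
    simpa [mul_assoc] using this
  · obtain ⟨γ, c, hc, e⟩ := h3 _ hg
    exact ⟨γ, c * x⁻¹, ⟨c, hc, rfl⟩, by rw [← mul_assoc, ← e, mul_inv_cancel_right]⟩

/-- The compactly induced representation `c-Ind_Γ^G ρ` (not normalized), on which `G` acts by right
translation. -/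
def cInd {G V : Type*} [Group G] [TopologicalSpace G] [IsTopologicalGroup G]
    [AddCommGroup V] [Module ℂ V] (Γ : Subgroup G) (ρ : Representation ℂ Γ V) :
    Representation ℂ G (cIndSpace Γ ρ) where
  toFun x :=
    { toFun := fun f => ⟨fun g => f.1 (g * x), cIndSpace_translate Γ ρ x f.2⟩
      map_add' := fun _ _ => rfl
      map_smul' := fun _ _ => rfl }
  map_one' := by
    ext f g
    simp
  map_mul' x y := by
    ext f g
    simp [mul_assoc]

/-- The inclusion of `H₁ × H₂` into a subgroup `Γ` of `G₁ × G₂` that contains it. -/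
def prodInclusion {G₁ G₂ : Type*} [Group G₁] [Group G₂] (H₁ : Subgroup G₁) (H₂ : Subgroup G₂)
    (Γ : Subgroup (G₁ × G₂)) (h : H₁.prod H₂ ≤ Γ) : H₁ × H₂ →* Γ :=
  (H₁.subtype.prodMap H₂.subtype).codRestrict Γ fun x => h ⟨x.1.2, x.2.2⟩

end

/-! A nonzero map `Φ` from the compactly induced representation to τ = π₁ ⊗ π₂ yields a nonzero
Γ-map `F : ρ → τ`, and both conclusions are read off from `F`.

Construction of `F`. As Γ need not be open, a vector v of ρ has to be approximated by functions. For
a compact open K such that v is fixed by Γ ∩ K, let δ(K, v) be the function supported on ΓK with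
value ρ(γ)v at γk, and multiply Φ(δ(K, v)) by the index of the image of K in that of a fixed K₀ in
the quotient by Γ. Passing to a smaller K' changes this vector by a combination of differences kt -
t with k in K (`IsLevel.approxMap_sub_mem`). A vector of this kind that is also fixed by K vanishes,
by averaging over K. Admissibility of τ on Γ puts suitable approximations in one finite-dimensional
space, which an open subgroup fixes pointwise, so they stabilize as K shrinks
(`exists_approxMap_eq`). The limit is F(v). It is equivariant because Γ is normal: conjugation by Γ
does not move the image of K in the quotient. It is nonzero because the δ(K, v) generate the induced
representation.

The bijection. Each set of constituents of πᵢ on Hᵢ is a single Gᵢ-orbit under twisting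
(`exists_twist_equiv`). Some pair σ ⊗ δ of constituents is a quotient of ρ, since `F` is nonzero.
The quotients of ρ are stable under twisting by Γ, and Γ projects onto both G₁ and G₂, so every
constituent on either side has a partner. The bigraph property makes partners unique.

Multiplicities. For δ in π₂, the map φ ↦ (1 ⊗ φ)F is injective on Hom(π₂, δ): the contractions of
the image of `F` span a G₂-stable subspace of π₂, hence all of it. If π₁ is multiplicity free, only
the component of (1 ⊗ φ)F at the partner σ of δ can be nonzero, and it lies in Hom(ρ, σ ⊗ δ), of
dimension at most 1. So m₂ ≤ 1; the converse is symmetric. -/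

/-! ### Detecting tensors by contractions -/

section TensorContraction

variable {V W : Type*} [AddCommGroup V] [Module ℂ V] [AddCommGroup W] [Module ℂ W]

theorem TensorProduct.eq_zero_of_forall_contract_left (x : V ⊗[ℂ] W)
    (h : ∀ l : V →ₗ[ℂ] ℂ, TensorProduct.lid ℂ W (l.rTensor W x) = 0) : x = 0 := by
  classical
  let b := Module.Basis.ofVectorSpace ℂ V
  have key : ∀ (x : V ⊗[ℂ] W) i, TensorProduct.equivFinsuppOfBasisLeft (N := W) b x i
      = TensorProduct.lid ℂ W ((b.coord i).rTensor W x) := by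
    intro x i
    induction x with
    | zero => simp
    | add x y hx hy => simp [hx, hy]
    | tmul v w => simp
  apply (TensorProduct.equivFinsuppOfBasisLeft (N := W) b).injective
  ext i
  rw [key, h, map_zero, Finsupp.zero_apply]

/-- Jointly injective linear maps stay so after tensoring on the left. -/
theorem TensorProduct.eq_zero_of_forall_lTensor {ι : Type*} {X : ι → Type*}
    [∀ i, AddCommGroup (X i)] [∀ i, Module ℂ (X i)] (q : ∀ i, W →ₗ[ℂ] X i)
    (hq : ∀ w, (∀ i, q i w = 0) → w = 0) (x : V ⊗[ℂ] W)
    (h : ∀ i, (q i).lTensor V x = 0) : x = 0 := by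
  refine TensorProduct.eq_zero_of_forall_contract_left x fun l => hq _ fun i => ?_
  have key : q i ∘ₗ (TensorProduct.lid ℂ W).toLinearMap ∘ₗ l.rTensor W
      = (TensorProduct.lid ℂ (X i)).toLinearMap ∘ₗ l.rTensor (X i) ∘ₗ (q i).lTensor V := by
    ext v w
    simp
  simpa only [LinearMap.comp_apply, LinearEquiv.coe_coe, h i, map_zero]
    using LinearMap.congr_fun key x

/-- Jointly injective linear maps stay so after tensoring on the right. -/
theorem TensorProduct.eq_zero_of_forall_rTensor {ι : Type*} {X : ι → Type*}
    [∀ i, AddCommGroup (X i)] [∀ i, Module ℂ (X i)] (q : ∀ i, V →ₗ[ℂ] X i)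
    (hq : ∀ v, (∀ i, q i v = 0) → v = 0) (x : V ⊗[ℂ] W)
    (h : ∀ i, (q i).rTensor W x = 0) : x = 0 := by
  apply (TensorProduct.comm ℂ V W).injective
  rw [map_zero]
  refine TensorProduct.eq_zero_of_forall_lTensor q hq _ fun i => ?_
  have key : (q i).lTensor W ∘ₗ (TensorProduct.comm ℂ V W).toLinearMap
      = (TensorProduct.comm ℂ (X i) W).toLinearMap ∘ₗ (q i).rTensor W := by
    ext v w
    simp
  simpa only [LinearMap.comp_apply, LinearEquiv.coe_coe, h i, map_zero]
    using LinearMap.congr_fun key x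

theorem TensorProduct.eq_zero_of_forall_map {ι κ : Type*}
    {X : ι → Type*} {Y : κ → Type*}
    [∀ i, AddCommGroup (X i)] [∀ i, Module ℂ (X i)] [∀ i, AddCommGroup (Y i)] [∀ i, Module ℂ (Y i)]
    (p : ∀ i, V →ₗ[ℂ] X i) (hp : ∀ v, (∀ i, p i v = 0) → v = 0)
    (q : ∀ i, W →ₗ[ℂ] Y i) (hq : ∀ w, (∀ i, q i w = 0) → w = 0) (x : V ⊗[ℂ] W)
    (h : ∀ i j, TensorProduct.map (p i) (q j) x = 0) : x = 0 := by
  refine TensorProduct.eq_zero_of_forall_rTensor p hp x fun i => ?_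
  refine TensorProduct.eq_zero_of_forall_lTensor q hq _ fun j => ?_
  rw [← LinearMap.comp_apply, LinearMap.lTensor_comp_rTensor, h]

end TensorContraction

/-! ### Irreducible representations and Schur's lemma -/

section Irreducible

variable {G V : Type*} [Group G] [AddCommGroup V] [Module ℂ V]

theorem Representation.IsIrreducible.eq_bot_or_eq_top_of_stable {ρ : Representation ℂ G V}
    (hρ : ρ.IsIrreducible) (S : Submodule ℂ V) (h : ∀ g, ∀ v ∈ S, ρ g v ∈ S) :
    S = ⊥ ∨ S = ⊤ := by
  rcases hρ.eq_bot_or_eq_top ⟨S, fun g v hv => h g v hv⟩ with h | h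
  · exact Or.inl (congrArg Subrepresentation.toSubmodule h)
  · exact Or.inr (congrArg Subrepresentation.toSubmodule h)

theorem Representation.IsIrreducible.nontrivial_space {ρ : Representation ℂ G V}
    (hρ : ρ.IsIrreducible) : Nontrivial V := by
  by_contra h
  rw [not_nontrivial_iff_subsingleton] at h
  exact bot_ne_top (α := Subrepresentation ρ)
    (Subrepresentation.toSubmodule_injective (Subsingleton.elim _ _))

theorem Representation.isIrreducible_of_forall_stable {ρ : Representation ℂ G V} [Nontrivial V]
    (h : ∀ S : Submodule ℂ V, (∀ g, ∀ v ∈ S, ρ g v ∈ S) → S ≠ ⊥ → S = ⊤) : ρ.IsIrreducible where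
  exists_pair_ne := ⟨⊥, ⊤, fun e => bot_ne_top (α := Submodule ℂ V)
    (congrArg Subrepresentation.toSubmodule e)⟩
  eq_bot_or_eq_top S := by
    by_cases hS : S.toSubmodule = ⊥
    · exact Or.inl (Subrepresentation.toSubmodule_injective hS)
    · exact Or.inr (Subrepresentation.toSubmodule_injective
        (h _ (fun g v hv => S.apply_mem_toSubmodule g hv) hS))

/-- The stabilizer of a vector. -/
def Representation.vecStabilizer (ρ : Representation ℂ G V) (v : V) : Subgroup G where
  carrier := {g | ρ g v = v}
  one_mem' := by simp
  mul_mem' := fun {a b} ha hb => by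
    simp only [Set.mem_ofPred_eq] at *
    rw [map_mul, Module.End.mul_apply, hb, ha]
  inv_mem' := fun {a} ha => by
    simp only [Set.mem_ofPred_eq] at *
    conv_lhs => rw [← ha]
    simp

theorem Representation.mem_vecStabilizer {ρ : Representation ℂ G V} {v : V} {g : G} :
    g ∈ ρ.vecStabilizer v ↔ ρ g v = v := Iff.rfl

/-- Schur's lemma for admissible representations. -/
theorem IsAdmissibleRep.exists_eq_smul [TopologicalSpace G]
    {ρ : Representation ℂ G V}
    (hρ : IsAdmissibleRep ρ) (hirr : ρ.IsIrreducible) (f : Representation.IntertwiningMap ρ ρ) :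
    ∃ c : ℂ, ∀ v, f v = c • v := by
  have := hirr.nontrivial_space
  obtain ⟨v, hv⟩ := exists_ne (0 : V)
  -- The vectors fixed by the stabilizer of `v` form a nonzero finite-dimensional space preserved by
  -- `f`. An eigenvalue `c` there makes `f - c` non-injective, hence zero.
  let K := ρ.vecStabilizer v
  have hfin := hρ.2 K (hρ.1 v)
  have hvK : v ∈ fixedVectors ρ K := fun k hk => hk
  have : Nontrivial (fixedVectors ρ K) := ⟨⟨v, hvK⟩, 0, fun e => hv (congrArg Subtype.val e)⟩
  let f' : Module.End ℂ (fixedVectors ρ K) := f.toLinearMap.restrict fun w hw k hk => by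
    change ρ k (f w) = f w
    rw [← f.isIntertwining, hw k hk]
  obtain ⟨c, hc⟩ := Module.End.exists_eigenvalue f'
  obtain ⟨w, hw, hw0⟩ := hc.exists_hasEigenvector
  refine ⟨c, ?_⟩
  have hfw : f w.1 = c • w.1 := congrArg Subtype.val (Module.End.mem_eigenspace_iff.1 hw)
  rcases Representation.IsIrreducible.injective_or_eq_zero
    (f - c • Representation.IntertwiningMap.id ρ) with hinj | h0
  · exact absurd (Subtype.ext (hinj (a₁ := w.1) (a₂ := 0) (by simp [hfw]))) hw0
  · intro v
    have := DFunLike.congr_fun h0 v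
    simpa [sub_eq_zero] using this

end Irreducible

/-! ### Irreducibility of external tensor products -/

section ExtTensor

variable {A B V W : Type*} [Group A] [Group B] [AddCommGroup V] [Module ℂ V]
    [AddCommGroup W] [Module ℂ W]

theorem extTensor_apply (σ : Representation ℂ A V) (δ : Representation ℂ B W) (g : A × B) :
    extTensor σ δ g = TensorProduct.map (σ g.1) (δ g.2) := rfl

/-- Jacobson density, over an irreducible representation all of whose endomorphisms are scalars. -/
theorem Representation.IsIrreducible.exists_asAlgebraHom_eq {σ : Representation ℂ A V}
    (hσ : σ.IsIrreducible)
    (hs : ∀ f : Representation.IntertwiningMap σ σ, ∃ c : ℂ, ∀ v, f v = c • v)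
    (T : V →ₗ[ℂ] V) (s : Finset V) : ∃ r, ∀ v ∈ s, T v = σ.asAlgebraHom r v := by
  have : IsSimpleModule (MonoidAlgebra ℂ A) σ.asModule :=
    (Representation.irreducible_iff_isSimpleModule_asModule σ).1 hσ
  -- Since the commutant consists of scalars, any linear map `T` commutes with it, and density
  -- applies to `T`.
  let T' : Module.End (Module.End (MonoidAlgebra ℂ A) σ.asModule) σ.asModule :=
    { toFun := T
      map_add' := T.map_add
      map_smul' := fun e v => by
        obtain ⟨c, hc⟩ := hs ((Representation.IntertwiningMap.equivLinearMapAsModule σ σ).symm e)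
        have hc' : ∀ w : V, e w = c • w := hc
        exact (congrArg T (hc' v)).trans ((T.map_smul c v).trans (hc' (T v)).symm) }
  obtain ⟨r, hr⟩ := jacobson_density T' s
  exact ⟨r, fun v hv => (hr v hv).trans rfl⟩

/-- By density, a stable subspace `S` is preserved by T ⊗ 1 for every linear T on V. A rank one T
turns a nonzero x in `S` into v ⊗ w with v arbitrary and w a nonzero contraction of x. So the space
`D` of those w with V ⊗ w inside `S` is nonzero and B-stable, hence everything. -/
theorem extTensor_isIrreducible {σ : Representation ℂ A V} {δ : Representation ℂ B W}
    (hσ : σ.IsIrreducible) (hδ : δ.IsIrreducible)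
    (hs : ∀ f : Representation.IntertwiningMap σ σ, ∃ c : ℂ, ∀ v, f v = c • v) :
    (extTensor σ δ).IsIrreducible := by
  have := hσ.nontrivial_space
  have := hδ.nontrivial_space
  refine Representation.isIrreducible_of_forall_stable fun S hS hne => ?_
  have hA : ∀ (r : MonoidAlgebra ℂ A), ∀ x ∈ S, (σ.asAlgebraHom r).rTensor W x ∈ S := by
    intro r x hx
    induction r using MonoidAlgebra.induction_linear with
    | zero => simp
    | add r r' h h' =>
      rw [map_add, LinearMap.rTensor_add]
      exact S.add_mem h h'
    | single g a =>
      rw [Representation.asAlgebraHom_single, LinearMap.rTensor_smul]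
      refine S.smul_mem a ?_
      have := hS (g, 1) x hx
      rwa [extTensor_apply, map_one] at this
  have hT : ∀ (T : V →ₗ[ℂ] V), ∀ x ∈ S, T.rTensor W x ∈ S := by
    classical
    intro T x hx
    obtain ⟨s, rfl⟩ := TensorProduct.exists_finset x
    obtain ⟨r, hr⟩ := hσ.exists_asAlgebraHom_eq hs T (s.image Prod.fst)
    convert hA r _ hx using 1
    rw [map_sum, map_sum]
    refine Finset.sum_congr rfl fun p hp => ?_
    rw [LinearMap.rTensor_tmul, LinearMap.rTensor_tmul, hr _ (Finset.mem_image_of_mem _ hp)]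
  obtain ⟨x, hx, hx0⟩ := Submodule.exists_mem_ne_zero_of_ne_bot hne
  obtain ⟨l, hl⟩ : ∃ l : V →ₗ[ℂ] ℂ, TensorProduct.lid ℂ W (l.rTensor W x) ≠ 0 := by
    by_contra h
    push Not at h
    exact hx0 (TensorProduct.eq_zero_of_forall_contract_left x h)
  let D : Submodule ℂ W := ⨅ v : V, S.comap (TensorProduct.mk ℂ V W v)
  have hD : ∀ w, w ∈ D ↔ ∀ v, v ⊗ₜ[ℂ] w ∈ S := fun w => by simp [D]
  have hDtop : D = ⊤ := by
    refine (hδ.eq_bot_or_eq_top_of_stable D fun g w hw => ?_).resolve_left fun hbot => hl ?_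
    · rw [hD] at hw ⊢
      intro v
      simpa [extTensor_apply] using hS (1, g) _ (hw v)
    · have : TensorProduct.lid ℂ W (l.rTensor W x) ∈ D := by
        rw [hD]
        intro v
        have key : (l.smulRight v).rTensor W = (TensorProduct.mk ℂ V W v) ∘ₗ
            (TensorProduct.lid ℂ W).toLinearMap ∘ₗ l.rTensor W := by
          ext a w
          simp [TensorProduct.smul_tmul]
        have h := hT (l.smulRight v) x hx
        rw [key] at h
        exact h
      rwa [hbot, Submodule.mem_bot] at this
  rw [eq_top_iff]
  intro y _
  induction y with
  | zero => exact S.zero_mem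
  | add a b ha hb => exact S.add_mem (ha trivial) (hb trivial)
  | tmul v w =>
    have hw : w ∈ D := hDtop ▸ trivial
    exact (hD w).1 hw v

end ExtTensor

/-! ### Smoothness and fixed vectors of external tensor products -/

section Smooth

variable {A B V W : Type*} [Group A] [Group B] [AddCommGroup V] [Module ℂ V]
    [AddCommGroup W] [Module ℂ W]
  [TopologicalSpace A] [TopologicalSpace B] [IsTopologicalGroup A] [IsTopologicalGroup B]

theorem extTensor_isSmooth {σ : Representation ℂ A V} {δ : Representation ℂ B W}
    (hσ : IsSmoothRep σ) (hδ : IsSmoothRep δ) : IsSmoothRep (extTensor σ δ) := by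
  intro x
  change IsOpen ((extTensor σ δ).vecStabilizer x : Set (A × B))
  induction x with
  | zero =>
    convert isOpen_univ
    ext g
    simp [Representation.mem_vecStabilizer]
  | add x y hx hy =>
    refine Subgroup.isOpen_mono (H₁ := (extTensor σ δ).vecStabilizer x ⊓
      (extTensor σ δ).vecStabilizer y) (fun g hg => ?_) (hx.inter hy)
    have h1 : _ = _ := hg.1
    have h2 : _ = _ := hg.2
    rw [Representation.mem_vecStabilizer, map_add, h1, h2]
  | tmul v w =>
    refine Subgroup.isOpen_mono (H₁ := (σ.vecStabilizer v).prod (δ.vecStabilizer w))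
      (fun g hg => ?_) ((hσ v).prod (hδ w))
    have h1 : _ = _ := hg.1
    have h2 : _ = _ := hg.2
    rw [Representation.mem_vecStabilizer, extTensor_apply, TensorProduct.map_tmul, h1, h2]

/-- Retractions of V onto P and of W onto Q, applied to the two legs, leave x unchanged, because
they fix all its contractions. -/
theorem TensorProduct.mem_range_map_subtype (P : Submodule ℂ V) (Q : Submodule ℂ W) (x : V ⊗[ℂ] W)
    (hP : ∀ l : W →ₗ[ℂ] ℂ, TensorProduct.rid ℂ V (l.lTensor V x) ∈ P)
    (hQ : ∀ l : V →ₗ[ℂ] ℂ, TensorProduct.lid ℂ W (l.rTensor W x) ∈ Q) :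
    x ∈ LinearMap.range (TensorProduct.map P.subtype Q.subtype) := by
  obtain ⟨p, hp⟩ := P.subtype.exists_leftInverse_of_injective (by simp)
  obtain ⟨q, hq⟩ := Q.subtype.exists_leftInverse_of_injective (by simp)
  have h1 : (P.subtype ∘ₗ p).rTensor W x = x := by
    rw [← sub_eq_zero]
    refine TensorProduct.eq_zero_of_forall_lTensor (ι := W →ₗ[ℂ] ℂ) (X := fun _ => ℂ) (fun l => l)
      (fun w hw => (Module.forall_dual_apply_eq_zero_iff ℂ w).1 hw) _ fun l => ?_
    have key : (TensorProduct.rid ℂ V).toLinearMap ∘ₗ l.lTensor V ∘ₗ (P.subtype ∘ₗ p).rTensor W =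
        (P.subtype ∘ₗ p) ∘ₗ (TensorProduct.rid ℂ V).toLinearMap ∘ₗ l.lTensor V := by
      ext v w
      simp
    apply (TensorProduct.rid ℂ V).injective
    rw [map_sub, map_sub, map_zero, sub_eq_zero]
    have h2 := LinearMap.congr_fun key x
    have h3 := LinearMap.congr_fun hp ⟨_, hP l⟩
    simp only [LinearMap.comp_apply, LinearEquiv.coe_coe] at h2
    rw [h2]
    exact congrArg Subtype.val h3
  have h1' : (Q.subtype ∘ₗ q).lTensor V x = x := by
    rw [← sub_eq_zero]
    refine TensorProduct.eq_zero_of_forall_contract_left _ fun l => ?_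
    have key : (TensorProduct.lid ℂ W).toLinearMap ∘ₗ l.rTensor W ∘ₗ (Q.subtype ∘ₗ q).lTensor V =
        (Q.subtype ∘ₗ q) ∘ₗ (TensorProduct.lid ℂ W).toLinearMap ∘ₗ l.rTensor W := by
      ext v w
      simp
    rw [map_sub, map_sub, sub_eq_zero]
    have h2 := LinearMap.congr_fun key x
    have h3 := LinearMap.congr_fun hq ⟨_, hQ l⟩
    simp only [LinearMap.comp_apply, LinearEquiv.coe_coe] at h2
    rw [h2]
    exact congrArg Subtype.val h3
  refine ⟨TensorProduct.map p q x, ?_⟩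
  rw [← LinearMap.comp_apply, ← TensorProduct.map_comp]
  conv_rhs => rw [← h1', ← h1]
  rw [← LinearMap.comp_apply, LinearMap.lTensor_comp_rTensor]

omit [IsTopologicalGroup A] [IsTopologicalGroup B] in
-- Contracting one leg of a vector fixed by K × L leaves a vector fixed by the group acting on the
-- other leg. So the vector lies in the tensor product of the two fixed spaces.
theorem extTensor_fixedVectors_finiteDimensional {σ : Representation ℂ A V}
    {δ : Representation ℂ B W} (hσ : IsAdmissibleRep σ) (hδ : IsAdmissibleRep δ)
    (K : Subgroup A) (hK : IsOpen (K : Set A)) (L : Subgroup B) (hL : IsOpen (L : Set B)) :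
    FiniteDimensional ℂ (fixedVectors (extTensor σ δ) (K.prod L)) := by
  have h1 := hσ.2 K hK
  have h2 := hδ.2 L hL
  refine Submodule.finiteDimensional_of_le (S₂ := LinearMap.range (TensorProduct.map
    (fixedVectors σ K).subtype (fixedVectors δ L).subtype)) fun x hx =>
    TensorProduct.mem_range_map_subtype _ _ x (fun l k hk => ?_) fun l k hk => ?_
  · have key : (TensorProduct.rid ℂ V).toLinearMap ∘ₗ l.lTensor V ∘ₗ extTensor σ δ (k, 1) =
        σ k ∘ₗ (TensorProduct.rid ℂ V).toLinearMap ∘ₗ l.lTensor V := by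
      ext v w
      simp [extTensor_apply]
    have := LinearMap.congr_fun key x
    simp only [LinearMap.comp_apply, LinearEquiv.coe_coe] at this
    rw [← this, hx (k, 1) ⟨hk, L.one_mem⟩]
  · have key : (TensorProduct.lid ℂ W).toLinearMap ∘ₗ l.rTensor W ∘ₗ extTensor σ δ (1, k) =
        δ k ∘ₗ (TensorProduct.lid ℂ W).toLinearMap ∘ₗ l.rTensor W := by
      ext v w
      simp [extTensor_apply]
    have := LinearMap.congr_fun key x
    simp only [LinearMap.comp_apply, LinearEquiv.coe_coe] at this
    rw [← this, hx (1, k) ⟨K.one_mem, hk⟩]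

end Smooth

/-! ### Compact open subgroups -/

section Topology

open Topology

/-- Van Dantzig's theorem. The subgroup is the stabilizer, under right translation, of a compact
open neighbourhood `W` of 1; it lies in `W` because 1 does. -/
theorem exists_isOpen_isCompact_subgroup {G : Type*} [Group G] [TopologicalSpace G]
    [IsTopologicalGroup G] [LocallyCompactSpace G] [TotallyDisconnectedSpace G] {U : Set G}
    (hU : U ∈ 𝓝 (1 : G)) :
    ∃ K : Subgroup G, IsOpen (K : Set G) ∧ IsCompact (K : Set G) ∧ (K : Set G) ⊆ U := by
  have : T1Space G := ⟨fun x => by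
    rw [← connectedComponent_eq_singleton x]
    exact isClosed_connectedComponent⟩
  obtain ⟨C, hC, hCU, hCc⟩ := LocallyCompactSpace.local_compact_nhds 1 U hU
  obtain ⟨W, hW, h1W, hWC⟩ := loc_compact_Haus_tot_disc_of_zero_dim.mem_nhds_iff.1 hC
  have hW : IsClopen W := hW
  have hWc : IsCompact W := hCc.of_isClosed_subset hW.1 hWC
  obtain ⟨N, hN, hWN⟩ := compact_open_separated_mul_right hWc hW.2 subset_rfl
  let K : Subgroup G :=
    { carrier := {g | ∀ w, w * g ∈ W ↔ w ∈ W}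
      one_mem' := by simp
      mul_mem' := fun {a b} ha hb w => by rw [← mul_assoc, hb, ha]
      inv_mem' := fun {a} ha w => by
        rw [← ha (w * a⁻¹), inv_mul_cancel_right] }
  have hKW : (K : Set G) ⊆ W := fun g hg => by
    have := (hg 1).2 h1W
    rwa [one_mul] at this
  have hKo : IsOpen (K : Set G) := by
    refine K.isOpen_of_mem_nhds (g := 1) (Filter.mem_of_superset
      (Filter.inter_mem hN (inv_mem_nhds_one G hN)) fun g hg w => ⟨fun h => ?_, fun h => ?_⟩)
    · have := hWN (Set.mul_mem_mul h hg.2)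
      rwa [mul_inv_cancel_right] at this
    · exact hWN (Set.mul_mem_mul h hg.1)
  exact ⟨K, hKo, hWc.of_isClosed_subset (K.isClosed_of_isOpen hKo) hKW, hKW.trans (hWC.trans hCU)⟩

theorem Subgroup.relIndex_ne_zero_of_isOpen_of_isCompact {G : Type*} [Group G] [TopologicalSpace G]
    [IsTopologicalGroup G] {K K' : Subgroup G} (hK : IsCompact (K : Set G))
    (hK' : IsOpen (K' : Set G)) : K'.relIndex K ≠ 0 := by
  have : CompactSpace K := isCompact_iff_compactSpace.1 hK
  have : Finite (K ⧸ K'.subgroupOf K) :=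
    Subgroup.quotient_finite_of_isOpen _ (hK'.preimage continuous_subtype_val)
  exact (Subgroup.finiteIndex_of_finite_quotient (H := K'.subgroupOf K)).index_ne_zero

theorem Subgroup.relIndex_map_ne_zero {G G' : Type*} [Group G] [Group G'] (f : G →* G')
    {K K' : Subgroup G} (h : K'.relIndex K ≠ 0) : (K'.map f).relIndex (K.map f) ≠ 0 := by
  have h1 : (K'.subgroupOf K).map (f.subgroupMap K) ≤ (K'.map f).subgroupOf (K.map f) := by
    rintro _ ⟨x, hx, rfl⟩
    exact ⟨x, hx, rfl⟩
  intro h0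
  refine h (Nat.eq_zero_of_zero_dvd ?_)
  rw [← Subgroup.index_eq_zero_of_relIndex_eq_zero (H := (K'.subgroupOf K).map (f.subgroupMap K))
    (K := ⊤)]
  · exact Subgroup.index_map_dvd _ (f.subgroupMap_surjective K)
  · rw [Subgroup.relIndex_top_right]
    exact Nat.eq_zero_of_zero_dvd (h0 ▸ Subgroup.index_dvd_of_le h1)

/-- Take the normal core of U ∩ K in K: it is closed of finite index, hence open. -/
theorem Subgroup.exists_isOpen_le_normalized {G : Type*} [Group G] [TopologicalSpace G]
    [IsTopologicalGroup G] {K U : Subgroup G} (hK : IsCompact (K : Set G))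
    (hKo : IsOpen (K : Set G)) (hU : IsOpen (U : Set G)) :
    ∃ N : Subgroup G, N ≤ U ∧ N ≤ K ∧ IsOpen (N : Set G) ∧
      ∀ k ∈ K, ∀ x, k⁻¹ * x * k ∈ N ↔ x ∈ N := by
  have : CompactSpace K := isCompact_iff_compactSpace.1 hK
  have hUo : IsOpen (U.subgroupOf K : Set K) := hU.preimage continuous_subtype_val
  have : Finite (K ⧸ U.subgroupOf K) := Subgroup.quotient_finite_of_isOpen _ hUo
  have : (U.subgroupOf K).FiniteIndex := Subgroup.finiteIndex_of_finite_quotient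
  let N := (U.subgroupOf K).normalCore
  have hN : IsOpen (N : Set K) := Subgroup.isOpen_of_isClosed_of_finiteIndex _
    (Subgroup.normalCore_isClosed _ (Subgroup.isClosed_of_isOpen _ hUo))
  refine ⟨N.map K.subtype, ?_, ?_, ?_, ?_⟩
  · rintro _ ⟨x, hx, rfl⟩
    exact Subgroup.normalCore_le (U.subgroupOf K) hx
  · rintro _ ⟨x, -, rfl⟩
    exact x.2
  · exact hKo.isOpenMap_subtype_val _ hN
  · have key : ∀ k ∈ K, ∀ x, x ∈ N.map K.subtype → k⁻¹ * x * k ∈ N.map K.subtype := by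
      rintro k hk _ ⟨x, hx, rfl⟩
      have := Subgroup.normalCore_normal (U.subgroupOf K)
      refine ⟨⟨k, hk⟩⁻¹ * x * ⟨k, hk⟩, ?_, rfl⟩
      have := this.conj_mem x hx ⟨k, hk⟩⁻¹
      rwa [inv_inv] at this
    refine fun k hk x => ⟨fun h => ?_, key k hk x⟩
    have := key k⁻¹ (K.inv_mem hk) _ h
    simpa [mul_assoc] using this

end Topology

/-! ### Averaging over a compact subgroup -/

section Coinvariants

variable {G T : Type*} [Group G] [AddCommGroup T] [Module ℂ T]

/-- The span of the differences `k t - t` for `k` in `K`. -/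
def augmentationSpan (τ : Representation ℂ G T) (K : Subgroup G) : Submodule ℂ T :=
  Submodule.span ℂ {x | ∃ k ∈ K, ∃ t, x = τ k t - t}

open MeasureTheory in
-- For a linear form l, the integral over K of l(k⁻¹t) vanishes on the augmentation span by
-- invariance of Haar measure, and equals vol(K) l(x) at a fixed vector x. Hence every l kills x.
theorem IsSmoothRep.eq_zero_of_mem_augmentationSpan [TopologicalSpace G] [IsTopologicalGroup G]
    {τ : Representation ℂ G T} (hτ : IsSmoothRep τ) {K : Subgroup G} (hK : IsCompact (K : Set G))
    {x : T} (hx : x ∈ augmentationSpan τ K) (hfix : x ∈ fixedVectors τ K) : x = 0 := by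
  have : CompactSpace K := isCompact_iff_compactSpace.1 hK
  borelize ↥K
  let μ : Measure K := Measure.haar
  rw [← Module.forall_dual_apply_eq_zero_iff ℂ]
  intro l
  have hcont : ∀ t, Continuous fun k : K => l (τ (k : G)⁻¹ t) := by
    intro t
    refine IsLocallyConstant.continuous ((IsLocallyConstant.iff_exists_open _).2 fun k => ?_)
    refine ⟨{k' : K | τ ((k : G) * (k' : G)⁻¹) t = t}, ?_, by simp, fun k' hk' => ?_⟩
    · have hc : Continuous fun k' : K => (k : G) * (k' : G)⁻¹ := by fun_prop
      exact (hτ t).preimage hc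
    · have hk'' : τ ((k : G) * (k' : G)⁻¹) t = t := hk'
      conv_rhs => rw [← hk'', ← Module.End.mul_apply, ← map_mul, inv_mul_cancel_left]
  have hint : ∀ t, Integrable (fun k : K => l (τ (k : G)⁻¹ t)) μ := fun t =>
    (hcont t).integrable_of_hasCompactSupport (HasCompactSupport.of_compactSpace _)
  let I : T →ₗ[ℂ] ℂ :=
    { toFun := fun t => ∫ k : K, l (τ (k : G)⁻¹ t) ∂μ
      map_add' := fun s t => by
        rw [← integral_add (hint s) (hint t)]
        simp
      map_smul' := fun c t => by
        rw [RingHom.id_apply, ← integral_smul]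
        simp }
  have hker : augmentationSpan τ K ≤ LinearMap.ker I := by
    rw [augmentationSpan, Submodule.span_le]
    rintro _ ⟨k, hk, t, rfl⟩
    rw [SetLike.mem_coe, LinearMap.mem_ker, map_sub, sub_eq_zero]
    have h := integral_mul_left_eq_self (μ := μ) (fun k' : K => l (τ (k' : G)⁻¹ t)) ⟨k, hk⟩⁻¹
    refine Eq.trans ?_ h
    refine integral_congr_ae (Filter.Eventually.of_forall fun k' => ?_)
    simp [map_mul]
  have h0 : I x = 0 := hker hx
  have h1 : I x = ∫ _ : K, l x ∂μ := integral_congr_ae (Filter.Eventually.of_forall fun k => by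
    change l (τ (k : G)⁻¹ x) = l x
    rw [hfix _ (K.inv_mem k.2)])
  rw [h1, integral_const, smul_eq_zero] at h0
  refine h0.resolve_left fun h => ?_
  have hpos : 0 < μ.real Set.univ := by
    rw [measureReal_def]
    exact ENNReal.toReal_pos (isOpen_univ.measure_pos μ Set.univ_nonempty).ne'
      (measure_lt_top μ _).ne
  exact hpos.ne' h

end Coinvariants

/-! ### Generators of the compactly induced representation -/

section Delta

variable {G V : Type*} [Group G] [AddCommGroup V] [Module ℂ V]
  (Γ : Subgroup G) (ρ : Representation ℂ Γ V)

/-- The conjugate `g K g⁻¹`. -/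
def Subgroup.conjBy (g : G) (K : Subgroup G) : Subgroup G :=
  K.comap (MulAut.conj g⁻¹).toMonoidHom

theorem Subgroup.mem_conjBy {g x : G} {K : Subgroup G} : x ∈ K.conjBy g ↔ g⁻¹ * x * g ∈ K := by
  simp [Subgroup.conjBy]

open Classical in
/-- The function supported on `Γ K` with value `ρ(γ) v` at `γ k`. -/
noncomputable def deltaFun (K : Subgroup G) (v : V) (g : G) : V :=
  if h : ∃ γ : Γ, (γ : G)⁻¹ * g ∈ K then ρ h.choose v else 0

/-- `v` is fixed by `Γ ∩ K`, where `K` is open and compact. -/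
structure IsLevel [TopologicalSpace G] (K : Subgroup G) (v : V) : Prop where
  isOpen : IsOpen (K : Set G)
  isCompact : IsCompact (K : Set G)
  fixed : ∀ γ : Γ, (γ : G) ∈ K → ρ γ v = v

variable {Γ ρ}

/-- Two choices of γ differ by an element of Γ ∩ K, which fixes v, so the choice in the definition
is immaterial. -/
theorem deltaFun_of_mem {K : Subgroup G} {v : V} (hv : ∀ γ : Γ, (γ : G) ∈ K → ρ γ v = v) (γ : Γ)
    {g : G} (h : (γ : G)⁻¹ * g ∈ K) : deltaFun Γ ρ K v g = ρ γ v := by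
  have hex : ∃ γ : Γ, (γ : G)⁻¹ * g ∈ K := ⟨γ, h⟩
  rw [deltaFun, dif_pos hex]
  have h1 : ρ (γ⁻¹ * hex.choose) v = v := hv _ (by
    have := K.mul_mem h (K.inv_mem hex.choose_spec)
    simpa [mul_assoc] using this)
  conv_rhs => rw [← h1, ← Module.End.mul_apply, ← map_mul, mul_inv_cancel_left]

theorem deltaFun_of_not {K : Subgroup G} {v : V} {g : G} (h : ¬ ∃ γ : Γ, (γ : G)⁻¹ * g ∈ K) :
    deltaFun Γ ρ K v g = 0 := dif_neg h

theorem deltaFun_mul_right {K : Subgroup G} {v : V} (hv : ∀ γ : Γ, (γ : G) ∈ K → ρ γ v = v)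
    {k : G} (hk : k ∈ K) (g : G) : deltaFun Γ ρ K v (g * k) = deltaFun Γ ρ K v g := by
  by_cases hg : ∃ γ : Γ, (γ : G)⁻¹ * g ∈ K
  · obtain ⟨γ', hγ'⟩ := hg
    rw [deltaFun_of_mem hv γ' hγ', deltaFun_of_mem hv γ' (by
      rw [← mul_assoc]; exact K.mul_mem hγ' hk)]
  · rw [deltaFun_of_not hg, deltaFun_of_not]
    rintro ⟨γ', hγ'⟩
    rw [← mul_assoc, K.mul_mem_cancel_right hk] at hγ'
    exact hg ⟨γ', hγ'⟩

theorem exists_inv_mul_mem_iff [Γ.Normal] {K : Subgroup G} {g : G} :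
    (∃ γ : Γ, (γ : G)⁻¹ * g ∈ K) ↔ QuotientGroup.mk' Γ g ∈ K.map (QuotientGroup.mk' Γ) := by
  constructor
  · rintro ⟨γ, hγ⟩
    refine ⟨_, hγ, ?_⟩
    rw [map_mul, map_inv]
    have : QuotientGroup.mk' Γ (γ : G) = 1 := (QuotientGroup.eq_one_iff _).2 γ.2
    rw [this, inv_one, one_mul]
  · rintro ⟨k, hk, he⟩
    have h1 : g * k⁻¹ ∈ Γ := by
      rw [← QuotientGroup.eq_one_iff, QuotientGroup.mk_mul, QuotientGroup.mk_inv, mul_inv_eq_one]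
      exact he.symm
    exact ⟨⟨_, h1⟩, by simpa [mul_assoc] using hk⟩

variable [TopologicalSpace G]

theorem IsLevel.mono {K K' : Subgroup G} {v : V} [IsTopologicalGroup G] (h : IsLevel Γ ρ K v)
    (hK' : IsOpen (K' : Set G)) (hle : K' ≤ K) : IsLevel Γ ρ K' v :=
  ⟨hK', h.isCompact.of_isClosed_subset (K'.isClosed_of_isOpen hK') hle,
    fun γ hγ => h.fixed γ (hle hγ)⟩

theorem IsLevel.add {K : Subgroup G} {v w : V} (h : IsLevel Γ ρ K v) (h' : IsLevel Γ ρ K w) :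
    IsLevel Γ ρ K (v + w) :=
  ⟨h.isOpen, h.isCompact, fun γ hγ => by rw [map_add, h.fixed γ hγ, h'.fixed γ hγ]⟩

theorem IsLevel.smul {K : Subgroup G} {v : V} (h : IsLevel Γ ρ K v) (c : ℂ) :
    IsLevel Γ ρ K (c • v) :=
  ⟨h.isOpen, h.isCompact, fun γ hγ => by rw [map_smul, h.fixed γ hγ]⟩

theorem isOpen_conjBy [IsTopologicalGroup G] {K : Subgroup G} (hK : IsOpen (K : Set G)) (g : G) :
    IsOpen (K.conjBy g : Set G) := by
  have hc : Continuous fun x : G => g⁻¹ * x * g := by fun_prop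
  convert hK.preimage hc using 1
  ext x
  exact Subgroup.mem_conjBy

theorem isCompact_conjBy [IsTopologicalGroup G] {K : Subgroup G} (hK : IsCompact (K : Set G))
    (g : G) : IsCompact (K.conjBy g : Set G) := by
  have hc : Continuous fun x : G => g * x * g⁻¹ := by fun_prop
  convert hK.image hc using 1
  ext x
  rw [SetLike.mem_coe, Subgroup.mem_conjBy]
  refine ⟨fun h => ⟨_, h, by group⟩, ?_⟩
  rintro ⟨y, hy, rfl⟩
  simpa [mul_assoc] using hy

theorem IsLevel.conjBy [IsTopologicalGroup G] {K : Subgroup G} {v : V} (h : IsLevel Γ ρ K v)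
    (γ : Γ) : IsLevel Γ ρ (K.conjBy (γ : G)) (ρ γ v) :=
  ⟨isOpen_conjBy h.isOpen _, isCompact_conjBy h.isCompact _, fun x hx => by
    have h1 := h.fixed (γ⁻¹ * x * γ) (Subgroup.mem_conjBy.1 hx)
    conv_rhs => rw [← h1]
    simp only [← Module.End.mul_apply, ← map_mul]
    congr 2
    group⟩

theorem IsLevel.deltaFun_mem {K : Subgroup G} {v : V} (h : IsLevel Γ ρ K v) :
    deltaFun Γ ρ K v ∈ cIndSpace Γ ρ := by
  refine ⟨fun γ g => ?_, ⟨K, h.isOpen, fun k hk g => ?_⟩, K, h.isCompact, fun g hg => ?_⟩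
  · by_cases hg : ∃ γ : Γ, (γ : G)⁻¹ * g ∈ K
    · obtain ⟨γ', hγ'⟩ := hg
      rw [deltaFun_of_mem h.fixed γ' hγ', deltaFun_of_mem h.fixed (γ * γ') (by
        simpa [mul_assoc] using hγ'), map_mul, Module.End.mul_apply]
    · rw [deltaFun_of_not hg, map_zero, deltaFun_of_not]
      rintro ⟨γ', hγ'⟩
      exact hg ⟨γ⁻¹ * γ', by simpa [mul_assoc] using hγ'⟩
  · exact deltaFun_mul_right h.fixed hk g
  · by_contra hne
    refine hg (deltaFun_of_not ?_)
    rintro ⟨γ, hγ⟩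
    exact hne ⟨γ, _, hγ, by group⟩

variable (Γ ρ) in
open Classical in
/-- The function `deltaFun` as a vector of the compactly induced representation. -/
noncomputable def cIndDelta (K : Subgroup G) (v : V) : cIndSpace Γ ρ :=
  if h : deltaFun Γ ρ K v ∈ cIndSpace Γ ρ then ⟨_, h⟩ else 0

theorem IsLevel.coe_cIndDelta {K : Subgroup G} {v : V} (h : IsLevel Γ ρ K v) :
    (cIndDelta Γ ρ K v : G → V) = deltaFun Γ ρ K v := by
  rw [cIndDelta, dif_pos h.deltaFun_mem]

theorem IsLevel.cIndDelta_add {K : Subgroup G} {v w : V} (h : IsLevel Γ ρ K v)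
    (h' : IsLevel Γ ρ K w) :
    cIndDelta Γ ρ K (v + w) = cIndDelta Γ ρ K v + cIndDelta Γ ρ K w := by
  ext g
  rw [Submodule.coe_add, (h.add h').coe_cIndDelta, h.coe_cIndDelta, h'.coe_cIndDelta, Pi.add_apply]
  by_cases hg : ∃ γ : Γ, (γ : G)⁻¹ * g ∈ K
  · simp [deltaFun, hg]
  · simp [deltaFun, hg]

theorem IsLevel.cIndDelta_smul {K : Subgroup G} {v : V} (h : IsLevel Γ ρ K v) (c : ℂ) :
    cIndDelta Γ ρ K (c • v) = c • cIndDelta Γ ρ K v := by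
  ext g
  rw [Submodule.coe_smul, (h.smul c).coe_cIndDelta, h.coe_cIndDelta, Pi.smul_apply]
  by_cases hg : ∃ γ : Γ, (γ : G)⁻¹ * g ∈ K
  · simp [deltaFun, hg]
  · simp [deltaFun, hg]

variable [IsTopologicalGroup G]

theorem cInd_apply_apply (x : G) (f : cIndSpace Γ ρ) (g : G) :
    (cInd Γ ρ x f : G → V) g = (f : G → V) (g * x) := rfl

theorem IsLevel.cInd_cIndDelta_of_mem {K : Subgroup G} {v : V} (h : IsLevel Γ ρ K v) {k : G}
    (hk : k ∈ K) : cInd Γ ρ k (cIndDelta Γ ρ K v) = cIndDelta Γ ρ K v := by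
  ext g
  rw [cInd_apply_apply, h.coe_cIndDelta, deltaFun_mul_right h.fixed hk]

theorem IsLevel.cInd_cIndDelta [Γ.Normal] {K : Subgroup G} {v : V} (h : IsLevel Γ ρ K v) (γ : Γ) :
    cInd Γ ρ γ (cIndDelta Γ ρ K v) = cIndDelta Γ ρ (K.conjBy (γ : G)) (ρ γ v) := by
  ext g
  rw [cInd_apply_apply, h.coe_cIndDelta, (h.conjBy γ).coe_cIndDelta]
  by_cases hg : ∃ γ' : Γ, (γ' : G)⁻¹ * (g * γ) ∈ K
  · obtain ⟨γ', hγ'⟩ := hg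
    rw [deltaFun_of_mem h.fixed γ' hγ', deltaFun_of_mem (h.conjBy γ).fixed (γ' * γ⁻¹),
      ← Module.End.mul_apply, ← map_mul, inv_mul_cancel_right]
    rw [Subgroup.mem_conjBy]
    simpa [mul_assoc] using hγ'
  · rw [deltaFun_of_not hg, deltaFun_of_not]
    rintro ⟨γ', hγ'⟩
    refine hg ⟨γ' * γ, ?_⟩
    rw [Subgroup.mem_conjBy] at hγ'
    simpa [mul_assoc] using hγ'

/-- The vector attached to `K` is a sum of translates of the vector attached to a smaller `K'`. -/
theorem IsLevel.exists_cIndDelta_eq_sum [Γ.Normal] {K K' : Subgroup G} {v : V}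
    (h : IsLevel Γ ρ K v) (hK' : IsOpen (K' : Set G)) (hle : K' ≤ K) :
    ∃ r : Fin ((K'.map (QuotientGroup.mk' Γ)).relIndex (K.map (QuotientGroup.mk' Γ))) → G,
      (∀ i, r i ∈ K) ∧ cIndDelta Γ ρ K v = ∑ i, cInd Γ ρ (r i) (cIndDelta Γ ρ K' v) := by
  classical
  have h' := h.mono hK' hle
  set q := QuotientGroup.mk' Γ
  let S := (K'.map q).subgroupOf (K.map q)
  have hne : S.index ≠ 0 := Subgroup.relIndex_map_ne_zero q
    (Subgroup.relIndex_ne_zero_of_isOpen_of_isCompact h.isCompact hK')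
  have : S.FiniteIndex := ⟨hne⟩
  let e : Fin ((K'.map q).relIndex (K.map q)) ≃ (K.map q) ⧸ S :=
    (Finite.equivFinOfCardEq (S.index_eq_card).symm).symm
  have hrep : ∀ x : (K.map q) ⧸ S, ∃ k : G, ∃ hk : k ∈ K,
      (QuotientGroup.mk (⟨q k, k, hk, rfl⟩ : K.map q) : (K.map q) ⧸ S) = x := by
    intro x
    obtain ⟨⟨_, k, hk, rfl⟩, hx⟩ := QuotientGroup.mk_surjective x
    exact ⟨k, hk, hx⟩
  choose r hrK hr using hrep
  refine ⟨fun i => r (e i), fun i => hrK _, ?_⟩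
  have := Fintype.ofFinite ((K.map q) ⧸ S)
  rw [Equiv.sum_comp e fun x => cInd Γ ρ (r x) (cIndDelta Γ ρ K' v)]
  ext g
  rw [h.coe_cIndDelta, Submodule.coe_sum, Finset.sum_apply]
  simp only [cInd_apply_apply, h'.coe_cIndDelta]
  by_cases hg : ∃ γ : Γ, (γ : G)⁻¹ * g ∈ K
  · obtain ⟨γ, hγ⟩ := hg
    rw [deltaFun_of_mem h.fixed γ hγ]
    have hqg : q g = q ((γ : G)⁻¹ * g) := by
      have : q (γ : G) = 1 := (QuotientGroup.eq_one_iff _).2 γ.2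
      rw [map_mul, map_inv, this, inv_one, one_mul]
    -- The only coset whose translate is nonzero at `g`. The inverse appears because right
    -- translation by r moves the support ΓK' to ΓK'r⁻¹.
    let x₀ : (K.map q) ⧸ S :=
      QuotientGroup.mk ⟨q ((γ : G)⁻¹ * g)⁻¹, _, K.inv_mem hγ, rfl⟩
    have hx₀ : ∀ x, (∃ γ' : Γ, (γ' : G)⁻¹ * (g * r x) ∈ K') ↔ x₀ = x := by
      intro x
      rw [exists_inv_mul_mem_iff]
      conv_rhs => rw [← hr x]
      rw [QuotientGroup.eq, Subgroup.mem_subgroupOf]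
      change q _ ∈ _ ↔ (q ((γ : G)⁻¹ * g)⁻¹)⁻¹ * q (r x) ∈ K'.map q
      rw [← map_inv, inv_inv, ← hqg, map_mul]
    rw [Finset.sum_eq_single x₀]
    · obtain ⟨γ', hγ'⟩ := (hx₀ x₀).2 rfl
      rw [deltaFun_of_mem h'.fixed γ' hγ']
      have h1 : ρ (γ⁻¹ * γ') v = v := h.fixed _ (by
        have := K.mul_mem (K.mul_mem hγ (hrK x₀)) (K.inv_mem (hle hγ'))
        simpa [mul_assoc] using this)
      conv_lhs => rw [← h1, ← Module.End.mul_apply, ← map_mul, mul_inv_cancel_left]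
    · intro x _ hx
      exact deltaFun_of_not fun hex => hx ((hx₀ x).1 hex).symm
    · intro hx
      exact absurd (Finset.mem_univ _) hx
  · rw [deltaFun_of_not hg]
    refine (Finset.sum_eq_zero fun x _ => deltaFun_of_not ?_).symm
    rintro ⟨γ, hγ⟩
    rw [← mul_assoc] at hγ
    exact hg ⟨γ, (K.mul_mem_cancel_right (hrK x)).1 (hle hγ)⟩

open Classical in
/-- The vectors attached to the pairs `(K, v)` generate the compactly induced representation. -/
theorem eq_zero_of_forall_cIndDelta_eq_zero {T : Type*} [AddCommGroup T] [Module ℂ T]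
    {τ : Representation ℂ G T} {K₀ : Subgroup G} (hK₀ : IsOpen (K₀ : Set G))
    (hK₀c : IsCompact (K₀ : Set G))
    (Φ : Representation.IntertwiningMap (cInd Γ ρ) τ)
    (h : ∀ K v, IsLevel Γ ρ K v → Φ (cIndDelta Γ ρ K v) = 0) : Φ = 0 := by
  -- Induction on the number of sets ΓcK that cover the support of a right K-invariant f.
  have main : ∀ (K : Subgroup G), IsOpen (K : Set G) → IsCompact (K : Set G) → ∀ s : Finset G,
      ∀ f : cIndSpace Γ ρ, (∀ k ∈ K, ∀ g, f.1 (g * k) = f.1 g) →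
      (∀ g, f.1 g ≠ 0 → ∃ γ : Γ, ∃ c ∈ s, c⁻¹ * (γ : G)⁻¹ * g ∈ K) → Φ f = 0 := by
    intro K hK hKc s
    induction s using Finset.induction_on with
    | empty =>
      intro f _ hf
      have : f = 0 := by
        ext g
        by_contra hg
        obtain ⟨γ, c, hc, -⟩ := hf g hg
        exact absurd hc (Finset.notMem_empty c)
      rw [this, map_zero]
    | insert c s _ ih =>
      intro f hfK hf
      have hlev : IsLevel Γ ρ (K.conjBy c) (f.1 c) := ⟨isOpen_conjBy hK c, isCompact_conjBy hKc c,
        fun γ hγ => by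
          rw [Subgroup.mem_conjBy] at hγ
          rw [← f.2.1 γ c, ← hfK _ hγ c]
          group⟩
      -- This translate agrees with f on ΓcK and vanishes elsewhere, so subtracting it removes c
      -- from the list.
      let f' : cIndSpace Γ ρ := cInd Γ ρ c⁻¹ (cIndDelta Γ ρ (K.conjBy c) (f.1 c))
      have hf' : ∀ g, f'.1 g = deltaFun Γ ρ (K.conjBy c) (f.1 c) (g * c⁻¹) := fun g => by
        rw [← hlev.coe_cIndDelta]
        rfl
      have hmem : ∀ (γ : Γ) g, (γ : G)⁻¹ * (g * c⁻¹) ∈ K.conjBy c ↔ c⁻¹ * (γ : G)⁻¹ * g ∈ K :=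
        fun γ g => by rw [Subgroup.mem_conjBy]; simp [mul_assoc]
      have hf'K : ∀ k ∈ K, ∀ g, f'.1 (g * k) = f'.1 g := by
        intro k hk g
        have hk' : c * k * c⁻¹ ∈ K.conjBy c := by
          rw [Subgroup.mem_conjBy]
          simpa [mul_assoc] using hk
        rw [hf', hf', ← deltaFun_mul_right hlev.fixed hk' (g * c⁻¹)]
        congr 1
        group
      have hΦ : Φ f' = 0 := by
        rw [Φ.isIntertwining, h _ _ hlev, map_zero]
      have h2 : Φ (f - f') = 0 := by
        refine ih _ (fun k hk g => ?_) fun g hg => ?_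
        · change f.1 _ - f'.1 _ = f.1 _ - f'.1 _
          rw [hfK k hk, hf'K k hk]
        · by_cases hgc : ∃ γ : Γ, c⁻¹ * (γ : G)⁻¹ * g ∈ K
          · obtain ⟨γ, hγ⟩ := hgc
            refine absurd ?_ hg
            change f.1 g - f'.1 g = 0
            rw [hf', deltaFun_of_mem hlev.fixed γ ((hmem γ g).2 hγ), ← f.2.1 γ c,
              ← hfK _ hγ (γ * c), sub_eq_zero]
            group
          · have hf'0 : f'.1 g = 0 := by
              rw [hf']
              exact deltaFun_of_not fun ⟨γ, hγ⟩ => hgc ⟨γ, (hmem γ g).1 hγ⟩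
            have hfg : f.1 g ≠ 0 := fun h0 => hg (by
              change f.1 g - f'.1 g = 0
              rw [h0, hf'0, sub_zero])
            obtain ⟨γ, c', hc', hk⟩ := hf g hfg
            rcases Finset.mem_insert.1 hc' with rfl | hc'
            · exact absurd ⟨γ, hk⟩ hgc
            · exact ⟨γ, c', hc', hk⟩
      rw [map_sub, hΦ, sub_zero] at h2
      exact h2
  ext f
  obtain ⟨h1, ⟨K, hK, h2⟩, C, hC, h3⟩ := f.2
  have hK' : IsOpen ((K ⊓ K₀ : Subgroup G) : Set G) := hK.inter hK₀
  obtain ⟨s, hs⟩ := hC.elim_finite_subcover (fun c : G => {g | c⁻¹ * g ∈ K ⊓ K₀})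
    (fun c => hK'.preimage (continuous_const_mul c⁻¹))
    (fun c _ => Set.mem_iUnion.2 ⟨c, by simp⟩)
  refine main (K ⊓ K₀) hK' (hK₀c.of_isClosed_subset (Subgroup.isClosed_of_isOpen _ hK')
    fun _ hx => hx.2) s f (fun k hk g => h2 k hk.1 g) fun g hg => ?_
  obtain ⟨γ, c, hc, rfl⟩ := h3 g hg
  obtain ⟨c', hc', hcc⟩ := Set.mem_iUnion₂.1 (hs hc)
  exact ⟨γ, c', hc', by simpa [mul_assoc] using hcc⟩

end Delta

/-! ### From quotients of the induced representation to quotients of ρ -/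

section Frobenius

variable {G V T : Type*} [Group G] [TopologicalSpace G] [IsTopologicalGroup G]
  [AddCommGroup V] [Module ℂ V] [AddCommGroup T] [Module ℂ T]
  {Γ : Subgroup G} [Γ.Normal] {ρ : Representation ℂ Γ V} {τ : Representation ℂ G T}

/-- The image of the vector attached to `K` and `v`, normalized by the index of the image of `K`
in that of `K₀`. -/
noncomputable def approxMap (K₀ : Subgroup G) (Φ : Representation.IntertwiningMap (cInd Γ ρ) τ)
    (K : Subgroup G) (v : V) : T :=
  ((K.map (QuotientGroup.mk' Γ)).relIndex (K₀.map (QuotientGroup.mk' Γ)) : ℂ) •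
    Φ (cIndDelta Γ ρ K v)

variable {K₀ : Subgroup G} {Φ : Representation.IntertwiningMap (cInd Γ ρ) τ}

/-- δ(K, v) is a sum of translates of δ(K', v) by elements of K. Modulo differences kt - t, its
image is therefore the index times that of δ(K', v), and multiplicativity of the index matches the
normalizations. -/
theorem IsLevel.approxMap_sub_mem {K K' : Subgroup G} {v : V} (h : IsLevel Γ ρ K v)
    (hK' : IsOpen (K' : Set G)) (hle : K' ≤ K) (hK : K ≤ K₀) :
    approxMap K₀ Φ K v - approxMap K₀ Φ K' v ∈ augmentationSpan τ K := by
  obtain ⟨r, hr, hsum⟩ := h.exists_cIndDelta_eq_sum hK' hle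
  have hmul := Subgroup.relIndex_mul_relIndex (K'.map (QuotientGroup.mk' Γ))
    (K.map (QuotientGroup.mk' Γ)) (K₀.map (QuotientGroup.mk' Γ)) (Subgroup.map_mono hle)
    (Subgroup.map_mono hK)
  have hdiff : Φ (cIndDelta Γ ρ K v) - ((K'.map (QuotientGroup.mk' Γ)).relIndex
      (K.map (QuotientGroup.mk' Γ)) : ℂ) • Φ (cIndDelta Γ ρ K' v) ∈ augmentationSpan τ K := by
    have : Φ (cIndDelta Γ ρ K v) - ((K'.map (QuotientGroup.mk' Γ)).relIndex
        (K.map (QuotientGroup.mk' Γ)) : ℂ) • Φ (cIndDelta Γ ρ K' v) =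
        ∑ i, (τ (r i) (Φ (cIndDelta Γ ρ K' v)) - Φ (cIndDelta Γ ρ K' v)) := by
      rw [Finset.sum_sub_distrib, Finset.sum_const, Finset.card_univ, Fintype.card_fin, hsum,
        map_sum, Nat.cast_smul_eq_nsmul]
      simp only [Φ.isIntertwining]
    rw [this]
    exact Submodule.sum_mem _ fun i _ => Submodule.subset_span ⟨r i, hr i, _, rfl⟩
  have h2 := Submodule.smul_mem _
    ((K.map (QuotientGroup.mk' Γ)).relIndex (K₀.map (QuotientGroup.mk' Γ)) : ℂ) hdiff
  rw [smul_sub, smul_smul, ← Nat.cast_mul, mul_comm, hmul] at h2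
  exact h2

theorem IsLevel.approxMap_mem_fixedVectors {K : Subgroup G} {v : V} (h : IsLevel Γ ρ K v) :
    approxMap K₀ Φ K v ∈ fixedVectors τ K := fun k hk => by
  rw [approxMap, map_smul, ← Φ.isIntertwining, h.cInd_cIndDelta_of_mem hk]

/-- Conjugation by γ in Γ does not change the image of K in the quotient by Γ, so the normalizing
index is the same on both sides and no modulus factor appears. -/
theorem IsLevel.rep_approxMap {K : Subgroup G} {v : V} (h : IsLevel Γ ρ K v) (γ : Γ) :
    τ γ (approxMap K₀ Φ K v) = approxMap K₀ Φ (K.conjBy (γ : G)) (ρ γ v) := by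
  have hq : (K.conjBy (γ : G)).map (QuotientGroup.mk' Γ) = K.map (QuotientGroup.mk' Γ) := by
    have hγ : QuotientGroup.mk' Γ (γ : G) = 1 := (QuotientGroup.eq_one_iff _).2 γ.2
    ext x
    constructor
    · rintro ⟨y, hy, rfl⟩
      exact ⟨_, Subgroup.mem_conjBy.1 hy, by simp only [map_mul, map_inv, hγ]; simp⟩
    · rintro ⟨y, hy, rfl⟩
      refine ⟨γ * y * (γ : G)⁻¹, ?_, by simp only [map_mul, map_inv, hγ]; simp⟩
      rw [SetLike.mem_coe, Subgroup.mem_conjBy]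
      simpa [mul_assoc] using hy
  rw [approxMap, map_smul, ← Φ.isIntertwining, h.cInd_cIndDelta, approxMap, hq]

omit [Γ.Normal] in
theorem IsSmoothRep.exists_isLevel (hρ : IsSmoothRep ρ)
    (hsmall : ∀ U ∈ nhds (1 : G), ∃ K : Subgroup G, IsOpen (K : Set G) ∧ (K : Set G) ⊆ U)
    (hK₀ : IsOpen (K₀ : Set G)) (hK₀c : IsCompact (K₀ : Set G)) (v : V) :
    ∃ K ≤ K₀, IsLevel Γ ρ K v := by
  obtain ⟨U, hU, hUv⟩ := isOpen_induced_iff.1 (hρ v)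
  have hmem : ∀ γ : Γ, (γ : G) ∈ U ↔ ρ γ v = v := fun γ => by
    change γ ∈ Subtype.val ⁻¹' U ↔ _
    rw [hUv]
    rfl
  obtain ⟨K, hK, hKU⟩ := hsmall U (hU.mem_nhds ((hmem 1).2 (by simp)))
  have ho : IsOpen ((K ⊓ K₀ : Subgroup G) : Set G) := hK.inter hK₀
  exact ⟨K ⊓ K₀, inf_le_right, ho, hK₀c.of_isClosed_subset (Subgroup.isClosed_of_isOpen _ ho)
    fun _ hx => hx.2, fun γ hγ => (hmem γ).1 (hKU hγ.1)⟩

/-- The approximations are eventually constant. -/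
theorem exists_approxMap_eq (hρ : IsSmoothRep ρ) (hτ : IsSmoothRep τ)
    (hfin : ∀ L : Subgroup Γ, IsOpen (L : Set Γ) →
      FiniteDimensional ℂ (fixedVectors (τ.comp Γ.subtype) L))
    (hsmall : ∀ U ∈ nhds (1 : G), ∃ K : Subgroup G, IsOpen (K : Set G) ∧ (K : Set G) ⊆ U)
    (hK₀ : IsOpen (K₀ : Set G)) (hK₀c : IsCompact (K₀ : Set G)) (v : V) :
    ∃ t, ∃ K₂ : Subgroup G, IsOpen (K₂ : Set G) ∧
      ∀ K ≤ K₂, IsOpen (K : Set G) → approxMap K₀ Φ K v = t := by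
  obtain ⟨K₁, hK₁₀, hK₁⟩ := hρ.exists_isLevel hsmall hK₀ hK₀c v
  set F := fixedVectors (τ.comp Γ.subtype) (K₁.subgroupOf Γ) with hF
  have hFfin : FiniteDimensional ℂ F := hfin _ (hK₁.isOpen.preimage continuous_subtype_val)
  -- The pointwise stabilizer of `F`, open because a finite spanning set suffices to define it. It
  -- contains Γ ∩ K₁ by the definition of `F`.
  let S : Subgroup G := ⨅ t ∈ F, τ.vecStabilizer t
  have hS : ∀ g ∈ S, ∀ t ∈ F, τ g t = t := fun g hg t ht => by
    simp only [S, Subgroup.mem_iInf] at hg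
    exact hg t ht
  have hSo : IsOpen (S : Set G) := by
    obtain ⟨s, hs⟩ := (Submodule.fg_iff_finiteDimensional F).2 hFfin
    refine Subgroup.isOpen_mono (H₁ := ⨅ t ∈ s, τ.vecStabilizer t) ?_ ?_
    · intro g hg
      simp only [S, Subgroup.mem_iInf] at hg ⊢
      intro t ht
      rw [← hs] at ht
      induction ht using Submodule.span_induction with
      | mem t ht => exact hg t ht
      | zero => rw [Representation.mem_vecStabilizer, map_zero]
      | add a b _ _ ha hb =>
        rw [Representation.mem_vecStabilizer] at *
        rw [map_add, ha, hb]
      | smul c a _ ha =>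
        rw [Representation.mem_vecStabilizer] at *
        rw [map_smul, ha]
    · have : ((⨅ t ∈ s, τ.vecStabilizer t : Subgroup G) : Set G) =
          ⋂ t ∈ s, (τ.vecStabilizer t : Set G) := by simp
      rw [this]
      exact isOpen_biInter_finset fun t _ => hτ t
  have hK₂o : IsOpen ((K₁ ⊓ S : Subgroup G) : Set G) := hK₁.isOpen.inter hSo
  have hK₂ : IsLevel Γ ρ (K₁ ⊓ S) v := hK₁.mono hK₂o inf_le_left
  have hLS : ∀ γ : Γ, (γ : G) ∈ K₁ → (γ : G) ∈ S := fun γ hγ => by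
    simp only [S, Subgroup.mem_iInf]
    exact fun t ht => ht γ hγ
  refine ⟨approxMap K₀ Φ (K₁ ⊓ S) v, K₁ ⊓ S, hK₂o, fun K hK hKo => ?_⟩
  -- As `N` is normalized by Γ ∩ K₁, its approximation is fixed by Γ ∩ K₁, so it lies in `F` and is
  -- fixed by `S`. The averaging lemma then equates it with the approximations at K₁ ∩ S and at `K`.
  obtain ⟨N, hNK, hNK₂, hNo, hNn⟩ := Subgroup.exists_isOpen_le_normalized hK₂.isCompact hK₂o hKo
  have hN : IsLevel Γ ρ N v := hK₂.mono hNo hNK₂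
  have hNF : approxMap K₀ Φ N v ∈ F := by
    intro γ hγ
    change τ γ _ = _
    have hγ₁ : (γ : G) ∈ K₁ := hγ
    rw [hN.rep_approxMap, hK₁.fixed γ hγ₁]
    congr 1
    ext x
    rw [Subgroup.mem_conjBy]
    exact hNn γ ⟨hγ₁, hLS γ hγ₁⟩ x
  have hNfix : approxMap K₀ Φ N v ∈ fixedVectors τ (K₁ ⊓ S) := fun k hk => hS k hk.2 _ hNF
  have h1 : approxMap K₀ Φ (K₁ ⊓ S) v - approxMap K₀ Φ N v = 0 :=
    hτ.eq_zero_of_mem_augmentationSpan hK₂.isCompact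
      (hK₂.approxMap_sub_mem hNo hNK₂ (inf_le_left.trans hK₁₀))
      (Submodule.sub_mem _ hK₂.approxMap_mem_fixedVectors hNfix)
  have hKl : IsLevel Γ ρ K v := hK₂.mono hKo hK
  have h2 : approxMap K₀ Φ K v - approxMap K₀ Φ N v = 0 :=
    hτ.eq_zero_of_mem_augmentationSpan hKl.isCompact
      (hKl.approxMap_sub_mem hNo hNK (hK.trans (inf_le_left.trans hK₁₀)))
      (Submodule.sub_mem _ hKl.approxMap_mem_fixedVectors fun k hk => hNfix k (hK hk))
  rw [sub_eq_zero] at h1 h2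
  rw [h1, h2]

/-- The half of Frobenius reciprocity for compact induction from a normal subgroup that turns a
quotient of the induced representation into a quotient of the inducing one. -/
theorem exists_intertwiningMap_ne_zero_of_cInd (hρ : IsSmoothRep ρ) (hτ : IsSmoothRep τ)
    (hfin : ∀ L : Subgroup Γ, IsOpen (L : Set Γ) →
      FiniteDimensional ℂ (fixedVectors (τ.comp Γ.subtype) L))
    (hsmall : ∀ U ∈ nhds (1 : G), ∃ K : Subgroup G, IsOpen (K : Set G) ∧ (K : Set G) ⊆ U)
    (hK₀ : IsOpen (K₀ : Set G)) (hK₀c : IsCompact (K₀ : Set G)) (hΦ : Φ ≠ 0) :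
    ∃ F : Representation.IntertwiningMap ρ (τ.comp Γ.subtype), F ≠ 0 := by
  have hex := exists_approxMap_eq (K₀ := K₀) (Φ := Φ) hρ hτ hfin hsmall hK₀ hK₀c
  have hlev := hρ.exists_isLevel hsmall hK₀ hK₀c
  choose F K₂ hK₂ hF using hex
  have hadd : ∀ v w, F (v + w) = F v + F w := by
    intro v w
    obtain ⟨K, -, hK⟩ := hlev v
    obtain ⟨K', -, hK'⟩ := hlev w
    let N := K ⊓ K' ⊓ (K₂ v ⊓ K₂ w ⊓ K₂ (v + w))
    have hN : IsOpen (N : Set G) :=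
      (hK.isOpen.inter hK'.isOpen).inter (((hK₂ v).inter (hK₂ w)).inter (hK₂ (v + w)))
    have h1 : IsLevel Γ ρ N v := hK.mono hN (inf_le_left.trans inf_le_left)
    have h2 : IsLevel Γ ρ N w := hK'.mono hN (inf_le_left.trans inf_le_right)
    rw [← hF v N (fun x hx => hx.2.1.1) hN, ← hF w N (fun x hx => hx.2.1.2) hN,
      ← hF (v + w) N (fun x hx => hx.2.2) hN, approxMap, h1.cIndDelta_add h2, map_add, smul_add]
    rfl
  have hsmul : ∀ (c : ℂ) v, F (c • v) = c • F v := by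
    intro c v
    obtain ⟨K, -, hK⟩ := hlev v
    let N := K ⊓ (K₂ v ⊓ K₂ (c • v))
    have hN : IsOpen (N : Set G) := hK.isOpen.inter ((hK₂ v).inter (hK₂ (c • v)))
    have h1 : IsLevel Γ ρ N v := hK.mono hN inf_le_left
    rw [← hF v N (fun x hx => hx.2.1) hN, ← hF (c • v) N (fun x hx => hx.2.2) hN, approxMap,
      h1.cIndDelta_smul, map_smul, smul_comm]
    rfl
  have hequiv : ∀ (γ : Γ) v, F (ρ γ v) = τ γ (F v) := by
    intro γ v
    obtain ⟨K, -, hK⟩ := hlev v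
    -- The last term ensures that γNγ⁻¹ is small enough to compute the limit at ρ(γ)v.
    let N := K ⊓ (K₂ v ⊓ (K₂ (ρ γ v)).conjBy (γ : G)⁻¹)
    have hN : IsOpen (N : Set G) :=
      hK.isOpen.inter ((hK₂ v).inter (isOpen_conjBy (hK₂ (ρ γ v)) _))
    have h1 : IsLevel Γ ρ N v := hK.mono hN inf_le_left
    rw [← hF v N (fun x hx => hx.2.1) hN, h1.rep_approxMap,
      hF (ρ γ v) (N.conjBy (γ : G)) (fun x hx => ?_) (isOpen_conjBy hN _)]
    have h2 := Subgroup.mem_conjBy.1 (Subgroup.mem_conjBy.1 hx).2.2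
    simpa [mul_assoc] using h2
  let F' : Representation.IntertwiningMap ρ (τ.comp Γ.subtype) :=
    { toFun := F
      map_add' := hadd
      map_smul' := hsmul
      isIntertwining' := fun γ => LinearMap.ext (hequiv γ) }
  refine ⟨F', fun h0 => hΦ ?_⟩
  have hF0 : ∀ v, F v = 0 := fun v => DFunLike.congr_fun h0 v
  refine eq_zero_of_forall_cIndDelta_eq_zero hK₀ hK₀c Φ fun K v hK => ?_
  -- If the limit is zero, then Φ kills δ(N, v), the index being nonzero, and so kills δ(K, v), a
  -- sum of translates of δ(N, v).
  let N := K ⊓ (K₂ v ⊓ K₀)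
  have hN : IsOpen (N : Set G) := hK.isOpen.inter ((hK₂ v).inter hK₀)
  have h1 : Φ (cIndDelta Γ ρ N v) = 0 := by
    have h2 := hF v N (fun x hx => hx.2.1) hN
    rw [hF0, approxMap, smul_eq_zero, Nat.cast_eq_zero] at h2
    exact h2.resolve_left (Subgroup.relIndex_map_ne_zero _
      (Subgroup.relIndex_ne_zero_of_isOpen_of_isCompact hK₀c hN))
  obtain ⟨r, -, hsum⟩ := hK.exists_cIndDelta_eq_sum hN inf_le_left
  rw [hsum, map_sum]
  exact Finset.sum_eq_zero fun i _ => by rw [Φ.isIntertwining, h1, map_zero]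

end Frobenius

/-! ### Uniqueness of the tensor factors -/

section TensorClasses

variable {A B V W V' W' : Type*} [Group A] [Group B] [AddCommGroup V] [Module ℂ V]
  [AddCommGroup W] [Module ℂ W] [AddCommGroup V'] [Module ℂ V'] [AddCommGroup W'] [Module ℂ W']
  {σ : Representation ℂ A V} {δ : Representation ℂ B W}
  {σ' : Representation ℂ A V'} {δ' : Representation ℂ B W'}

/-- The external tensor product of two intertwining maps. -/
noncomputable def extTensorMap (f : Representation.IntertwiningMap σ σ')
    (f' : Representation.IntertwiningMap δ δ') :
    Representation.IntertwiningMap (extTensor σ δ) (extTensor σ' δ') where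
  toLinearMap := TensorProduct.map f.toLinearMap f'.toLinearMap
  isIntertwining' g := by
    rw [extTensor_apply, extTensor_apply, ← TensorProduct.map_comp, ← TensorProduct.map_comp,
      f.isIntertwining', f'.isIntertwining']

/-- The external tensor product of two equivalences. -/
noncomputable def extTensorEquiv (e : σ.Equiv σ') (e' : δ.Equiv δ') :
    (extTensor σ δ).Equiv (extTensor σ' δ') :=
  .mk (TensorProduct.congr e.toLinearEquiv e'.toLinearEquiv)
    (extTensorMap e.toIntertwiningMap e'.toIntertwiningMap).isIntertwining'

theorem Representation.IntertwiningMap.equiv_comp_ne_zero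
    {U : Type*} [AddCommGroup U] [Module ℂ U] {ρ : Representation ℂ A U}
    (e : σ.Equiv σ') {f : Representation.IntertwiningMap ρ σ} (hf : f ≠ 0) :
    e.toIntertwiningMap.comp f ≠ 0 := by
  refine fun h => hf (DFunLike.ext _ _ fun v => ?_)
  have h1 : e (f v) = e 0 := (DFunLike.congr_fun h v).trans (map_zero e).symm
  exact e.injective h1

theorem Representation.IsIrreducible.nonempty_equiv (hσ : σ.IsIrreducible)
    (hσ' : σ'.IsIrreducible) {f : Representation.IntertwiningMap σ σ'} (hf : f ≠ 0) :
    Nonempty (σ.Equiv σ') :=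
  ⟨f.ofBijective ((Representation.IsIrreducible.bijective_or_eq_zero f).resolve_right hf)⟩

/-- Each map v ↦ (1 ⊗ l)(e(v ⊗ w)) intertwines σ and σ'. If all of them were zero, e would kill
every v ⊗ w; a nonzero one is an isomorphism by irreducibility. -/
theorem extTensor_fst_equiv (hσ : σ.IsIrreducible) (hδ : δ.IsIrreducible)
    (hσ' : σ'.IsIrreducible) (e : (extTensor σ δ).Equiv (extTensor σ' δ')) :
    Nonempty (σ.Equiv σ') := by
  have := hσ.nontrivial_space
  have := hδ.nontrivial_space
  let f (w : W) (l : W' →ₗ[ℂ] ℂ) : Representation.IntertwiningMap σ σ' :=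
    { toLinearMap := (TensorProduct.rid ℂ V').toLinearMap ∘ₗ l.lTensor V' ∘ₗ e.toLinearMap ∘ₗ
        (TensorProduct.mk ℂ V W).flip w
      isIntertwining' := fun a => by
        have key : (TensorProduct.rid ℂ V').toLinearMap ∘ₗ l.lTensor V' ∘ₗ extTensor σ' δ' (a, 1) =
            σ' a ∘ₗ (TensorProduct.rid ℂ V').toLinearMap ∘ₗ l.lTensor V' := by
          ext v w
          simp [extTensor_apply]
        ext v
        have h1 := e.isIntertwining _ _ (a, 1) (v ⊗ₜ w)
        have h2 := LinearMap.congr_fun key (e (v ⊗ₜ w))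
        have h3 : extTensor σ δ (a, 1) (v ⊗ₜ w) = (σ a v) ⊗ₜ w := by simp [extTensor_apply]
        rw [h3] at h1
        refine Eq.trans ?_ h2
        exact congrArg (fun x => TensorProduct.rid ℂ V' (l.lTensor V' x)) h1 }
  by_contra hne
  have hf : ∀ w l, f w l = 0 := fun w l => by
    by_contra h
    exact hne (hσ.nonempty_equiv hσ' h)
  obtain ⟨v, hv⟩ := exists_ne (0 : V)
  obtain ⟨w, hw⟩ := exists_ne (0 : W)
  have h0 : e (v ⊗ₜ w) = 0 := by
    refine TensorProduct.eq_zero_of_forall_lTensor (ι := W' →ₗ[ℂ] ℂ) (X := fun _ => ℂ)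
      (fun l => l) (fun w hw => (Module.forall_dual_apply_eq_zero_iff ℂ w).1 hw) _ fun l => ?_
    apply (TensorProduct.rid ℂ V').injective
    rw [map_zero]
    exact DFunLike.congr_fun (hf w l) v
  have h1 : v ⊗ₜ[ℂ] w = 0 := e.injective (h0.trans (map_zero e).symm)
  refine hv ((Module.forall_dual_apply_eq_zero_iff ℂ v).1 fun l => ?_)
  have h2 := congrArg (fun x => TensorProduct.lid ℂ W (l.rTensor W x)) h1
  simpa [hw] using h2

/-- Exchange of the two factors of an equivalence of external tensor products. -/
noncomputable def extTensorCommEquiv (e : (extTensor σ δ).Equiv (extTensor σ' δ')) :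
    (extTensor δ σ).Equiv (extTensor δ' σ') :=
  .mk ((TensorProduct.comm ℂ W V).trans (e.toLinearEquiv.trans (TensorProduct.comm ℂ V' W')))
    fun g => by
      have key : ∀ (x : W ⊗[ℂ] V), TensorProduct.comm ℂ W V (extTensor δ σ g x) =
          extTensor σ δ g.swap (TensorProduct.comm ℂ W V x) := by
        intro x
        induction x with
        | zero => simp
        | add x y hx hy => simp [hx, hy]
        | tmul v w => simp [extTensor_apply]
      have key' : ∀ (x : V' ⊗[ℂ] W'), TensorProduct.comm ℂ V' W' (extTensor σ' δ' g.swap x) =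
          extTensor δ' σ' g (TensorProduct.comm ℂ V' W' x) := by
        intro x
        induction x with
        | zero => simp
        | add x y hx hy => simp [hx, hy]
        | tmul v w => simp [extTensor_apply]
      refine LinearMap.ext fun x => ?_
      change TensorProduct.comm ℂ V' W' (e (TensorProduct.comm ℂ W V (extTensor δ σ g x))) = _
      have h := e.isIntertwining _ _ g.swap (TensorProduct.comm ℂ W V x)
      rw [key]
      exact (congrArg _ h).trans (key' _)

theorem extTensor_snd_equiv (hσ : σ.IsIrreducible) (hδ : δ.IsIrreducible)
    (hδ' : δ'.IsIrreducible) (e : (extTensor σ δ).Equiv (extTensor σ' δ')) :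
    Nonempty (δ.Equiv δ') :=
  extTensor_fst_equiv hδ hσ hδ' (extTensorCommEquiv e)

end TensorClasses

/-! ### Isomorphism classes and the bigraph property -/

section Classes

variable {A B : Type u} [Group A] [TopologicalSpace A] [Group B] [TopologicalSpace B]

theorem SmoothIrrep.toIrr_eq_iff {σ σ' : SmoothIrrep A} :
    σ.toIrr = σ'.toIrr ↔ Nonempty (σ.rep.Equiv σ'.rep) := Quotient.eq

theorem Irr.toIrr_out (c : Irr A) : c.out.toIrr = c := Quotient.out_eq c

theorem exists_ne_zero_of_toIrr_mem_quotientSet {V : Type*} [AddCommGroup V] [Module ℂ V]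
    {ρ : Representation ℂ A V} {σ : SmoothIrrep A} (h : σ.toIrr ∈ quotientSet ρ) :
    ∃ f : Representation.IntertwiningMap ρ σ.rep, f ≠ 0 := by
  obtain ⟨π, hπ, f, hf⟩ := h
  obtain ⟨e⟩ := SmoothIrrep.toIrr_eq_iff.1 hπ
  exact ⟨_, Representation.IntertwiningMap.equiv_comp_ne_zero e hf⟩

theorem TensorMemQuotientSet.exists_ne_zero {V : Type*} [AddCommGroup V] [Module ℂ V]
    {ρ : Representation ℂ (A × B) V} {σ : SmoothIrrep A} {δ : SmoothIrrep B}
    (h : TensorMemQuotientSet ρ σ.toIrr δ.toIrr) :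
    ∃ f : Representation.IntertwiningMap ρ (extTensor σ.rep δ.rep), f ≠ 0 := by
  obtain ⟨_, ht, τ, σ', δ', rfl, hσ, hδ, ⟨e⟩⟩ := h
  obtain ⟨f, hf⟩ := exists_ne_zero_of_toIrr_mem_quotientSet ht
  obtain ⟨e₁⟩ := SmoothIrrep.toIrr_eq_iff.1 hσ
  obtain ⟨e₂⟩ := SmoothIrrep.toIrr_eq_iff.1 hδ
  exact ⟨_, Representation.IntertwiningMap.equiv_comp_ne_zero (e.trans (extTensorEquiv e₁ e₂)) hf⟩

theorem IsTensorClass.unique {t : Irr (A × B)} {s s' : Irr A} {d d' : Irr B}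
    (h : IsTensorClass t s d) (h' : IsTensorClass t s' d') : s = s' ∧ d = d' := by
  obtain ⟨τ, σ, δ, rfl, rfl, rfl, ⟨e⟩⟩ := h
  obtain ⟨τ', σ', δ', ht, rfl, rfl, ⟨e'⟩⟩ := h'
  obtain ⟨e''⟩ := SmoothIrrep.toIrr_eq_iff.1 ht
  let E := (e.symm.trans e''.symm).trans e'
  exact ⟨SmoothIrrep.toIrr_eq_iff.2
      (extTensor_fst_equiv σ.irreducible δ.irreducible σ'.irreducible E),
    SmoothIrrep.toIrr_eq_iff.2
      (extTensor_snd_equiv σ.irreducible δ.irreducible δ'.irreducible E)⟩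

theorem IsStrongBigraphRep.snd_unique {V : Type*} [AddCommGroup V] [Module ℂ V]
    {ρ : Representation ℂ (A × B) V} (hρ : IsStrongBigraphRep ρ) {s : Irr A} {d d' : Irr B}
    (h : TensorMemQuotientSet ρ s d) (h' : TensorMemQuotientSet ρ s d') : d = d' := by
  obtain ⟨t, ht, hc⟩ := h
  obtain ⟨t', ht', hc'⟩ := h'
  obtain rfl := hρ.fst_injective t ht t' ht' s d d' hc hc'
  exact (hc.unique hc').2

theorem IsStrongBigraphRep.fst_unique {V : Type*} [AddCommGroup V] [Module ℂ V]
    {ρ : Representation ℂ (A × B) V} (hρ : IsStrongBigraphRep ρ) {s s' : Irr A} {d : Irr B}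
    (h : TensorMemQuotientSet ρ s d) (h' : TensorMemQuotientSet ρ s' d) : s = s' := by
  obtain ⟨t, ht, hc⟩ := h
  obtain ⟨t', ht', hc'⟩ := h'
  obtain rfl := hρ.snd_injective t ht t' ht' s s' d hc hc'
  exact (hc.unique hc').1

variable [IsTopologicalGroup A] [IsTopologicalGroup B]

/-- The external tensor product of irreducible smooth representations, the first one admissible. -/
noncomputable def SmoothIrrep.tensor (σ : SmoothIrrep A) (δ : SmoothIrrep B)
    (hσ : IsAdmissibleRep σ.rep) : SmoothIrrep (A × B) where
  V := σ.V ⊗[ℂ] δ.V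
  rep := extTensor σ.rep δ.rep
  smooth := extTensor_isSmooth σ.smooth δ.smooth
  irreducible := extTensor_isIrreducible σ.irreducible δ.irreducible
    fun f => hσ.exists_eq_smul σ.irreducible f

theorem tensorMemQuotientSet_of_ne_zero {V : Type*} [AddCommGroup V] [Module ℂ V]
    {ρ : Representation ℂ (A × B) V} {σ : SmoothIrrep A} {δ : SmoothIrrep B}
    (hσ : IsAdmissibleRep σ.rep)
    {f : Representation.IntertwiningMap ρ (extTensor σ.rep δ.rep)} (hf : f ≠ 0) :
    TensorMemQuotientSet ρ σ.toIrr δ.toIrr :=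
  ⟨(σ.tensor δ hσ).toIrr, ⟨σ.tensor δ hσ, rfl, f, hf⟩, σ.tensor δ hσ, σ, δ, rfl, rfl, rfl,
    ⟨Representation.Equiv.refl _⟩⟩

/-- Multiplicity one, phrased as linear dependence so that it can be transported along φ ↦ (1 ⊗ φ)F.
-/
theorem IsStrongBigraphRep.exists_smul_add_smul_eq_zero {V : Type*} [AddCommGroup V] [Module ℂ V]
    {ρ : Representation ℂ (A × B) V} (hρ : IsStrongBigraphRep ρ) {σ : SmoothIrrep A}
    {δ : SmoothIrrep B} (hσ : IsAdmissibleRep σ.rep)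
    (f f' : Representation.IntertwiningMap ρ (extTensor σ.rep δ.rep)) :
    ∃ a b : ℂ, (a ≠ 0 ∨ b ≠ 0) ∧ a • f + b • f' = 0 := by
  obtain ⟨f₀, h⟩ := rank_le_one_iff.1 (hρ.multiplicity_free (σ.tensor δ hσ))
  obtain ⟨r, hr⟩ := h f
  obtain ⟨r', hr'⟩ := h f'
  by_cases h0 : r = 0
  · exact ⟨1, 0, Or.inl one_ne_zero, by rw [← hr, h0]; simp; rfl⟩
  · refine ⟨r', -r, Or.inr (neg_ne_zero.2 h0), ?_⟩
    rw [← hr, ← hr']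
    have : r' • r • f₀ + (-r) • r' • f₀ = 0 := by
      rw [smul_smul, smul_smul, ← add_smul]
      ring_nf
      exact zero_smul ℂ f₀
    exact this

end Classes

/-! ### Clifford theory: twisting by the ambient group -/

section Clifford

variable {G : Type u} [Group G] [TopologicalSpace G] [IsTopologicalGroup G] {H : Subgroup G}
  [H.Normal]

/-- The twist of a representation of a normal subgroup by an element of the group. -/
def SmoothIrrep.twist (σ : SmoothIrrep H) (g : G) : SmoothIrrep H where
  V := σ.V
  rep := σ.rep.comp (MulAut.conjNormal g : MulAut H).toMonoidHom
  smooth v := by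
    have hc : Continuous (MulAut.conjNormal g : MulAut H) := by
      refine Continuous.subtype_mk (f := fun h : H => g * h * g⁻¹) (by fun_prop) _
    exact (σ.smooth v).preimage hc
  irreducible := by
    have := σ.irreducible.nontrivial_space
    refine Representation.isIrreducible_of_forall_stable fun S hS hne =>
      (σ.irreducible.eq_bot_or_eq_top_of_stable S fun h v hv => ?_).resolve_left hne
    have := hS ((MulAut.conjNormal g : MulAut H).symm h) v hv
    simpa using this

omit [TopologicalSpace G] [IsTopologicalGroup G] in
theorem rep_conjNormal_comm {V : Type*} [AddCommGroup V] [Module ℂ V] (π : Representation ℂ G V)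
    (g : G) (h : H) (v : V) : π g (π (h : G) v) = π (MulAut.conjNormal g h : H) (π g v) := by
  rw [← Module.End.mul_apply, ← map_mul, ← Module.End.mul_apply, ← map_mul,
    MulAut.conjNormal_apply, inv_mul_cancel_right]

/-- Precomposition with `π g` twists an intertwining map. -/
def twistMap {V : Type*} [AddCommGroup V] [Module ℂ V] {π : Representation ℂ G V}
    {σ : SmoothIrrep H} (f : Representation.IntertwiningMap (π.comp H.subtype) σ.rep) (g : G) :
    Representation.IntertwiningMap (π.comp H.subtype) (σ.twist g).rep where
  toLinearMap := f.toLinearMap ∘ₗ π g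
  isIntertwining' h := by
    refine LinearMap.ext fun v => ?_
    change f (π g (π (h : G) v)) = σ.rep (MulAut.conjNormal g h) (f (π g v))
    rw [rep_conjNormal_comm]
    exact f.isIntertwining _ _ (MulAut.conjNormal g h) (π g v)

theorem twist_mem_quotientSet {V : Type*} [AddCommGroup V] [Module ℂ V] {π : Representation ℂ G V}
    {σ : SmoothIrrep H} (h : σ.toIrr ∈ quotientSet (π.comp H.subtype)) (g : G) :
    (σ.twist g).toIrr ∈ quotientSet (π.comp H.subtype) := by
  obtain ⟨f, hf⟩ := exists_ne_zero_of_toIrr_mem_quotientSet h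
  refine ⟨_, rfl, twistMap f g, fun h0 => hf (DFunLike.ext _ _ fun v => ?_)⟩
  have h1 : f (π g (π g⁻¹ v)) = 0 := DFunLike.congr_fun h0 (π g⁻¹ v)
  rwa [← Module.End.mul_apply, ← map_mul, mul_inv_cancel, map_one] at h1

/-- The G-translates of the image of ι span π, so f ∘ π(g) ∘ ι is nonzero for some g. It is a
nonzero map from σ' to the twist of σ by g, hence an isomorphism. -/
theorem exists_twist_equiv {V : Type*} [AddCommGroup V] [Module ℂ V] {π : Representation ℂ G V}
    (hπ : π.IsIrreducible) {σ σ' : SmoothIrrep H} (h : σ.toIrr ∈ quotientSet (π.comp H.subtype))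
    {ι : Representation.IntertwiningMap σ'.rep (π.comp H.subtype)} (hι : ι ≠ 0) :
    ∃ g : G, (σ.twist g).toIrr = σ'.toIrr := by
  obtain ⟨f, hf⟩ := exists_ne_zero_of_toIrr_mem_quotientSet h
  by_contra! hne
  have h0 : ∀ g w, f (π g (ι w)) = 0 := by
    intro g w
    by_contra hw
    refine hne g (SmoothIrrep.toIrr_eq_iff.2 ?_)
    obtain ⟨e⟩ := σ'.irreducible.nonempty_equiv (σ.twist g).irreducible
      (f := (twistMap f g).comp ι) (fun h0 => hw (DFunLike.congr_fun h0 w))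
    exact ⟨e.symm⟩
  let S : Submodule ℂ V := Submodule.span ℂ {x | ∃ g w, x = π g (ι w)}
  have hS : S ≤ LinearMap.ker f.toLinearMap := by
    rw [Submodule.span_le]
    rintro _ ⟨g, w, rfl⟩
    exact h0 g w
  rcases hπ.eq_bot_or_eq_top_of_stable S fun g v hv => by
    induction hv using Submodule.span_induction with
    | mem x hx =>
      obtain ⟨g', w, rfl⟩ := hx
      refine Submodule.subset_span ⟨g * g', w, ?_⟩
      rw [map_mul, Module.End.mul_apply]
    | zero => simp
    | add x y _ _ hx hy => rw [map_add]; exact S.add_mem hx hy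
    | smul c x _ hx => rw [map_smul]; exact S.smul_mem c hx with hbot | htop
  · refine hι (DFunLike.ext _ _ fun w => ?_)
    have : ι w ∈ S := Submodule.subset_span ⟨1, w, by simp⟩
    rw [hbot] at this
    exact this
  · refine hf (DFunLike.ext _ _ fun v => ?_)
    exact hS (htop ▸ trivial : v ∈ S)

end Clifford

/-! ### Multiplicities and the injectivity of φ ↦ (1 ⊗ φ)F -/

section Multiplicity

/-- What is used of the decomposition: jointly injective projections, with sections that separate
the copies of one constituent. -/
theorem IsSumWithMultiplicity.exists_projections {H : Type u} {V : Type*} [Group H]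
    [TopologicalSpace H] [AddCommGroup V] [Module ℂ V] {π : Representation ℂ H V} {m : ℕ}
    (h : IsSumWithMultiplicity π m) :
    ∃ (p : ∀ i : quotientSet π × Fin m, Representation.IntertwiningMap π (i.1 : Irr H).out.rep)
      (ι : ∀ i : quotientSet π × Fin m, Representation.IntertwiningMap (i.1 : Irr H).out.rep π),
      (∀ v, (∀ i, p i v = 0) → v = 0) ∧ (∀ i w, p i (ι i w) = w) ∧
      ∀ (c : quotientSet π) (j k : Fin m), j ≠ k → ∀ w, p (c, j) (ι (c, k) w) = 0 := by
  classical
  obtain ⟨e⟩ := h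
  refine ⟨fun i =>
    { toLinearMap := DirectSum.component ℂ _ _ i ∘ₗ e.toLinearMap
      isIntertwining' := fun g => LinearMap.ext fun v => ?_ }, fun i =>
    { toLinearMap := e.symm.toLinearMap ∘ₗ
        DirectSum.lof ℂ _ (fun i : quotientSet π × Fin m => (i.1 : Irr H).out.V) i
      isIntertwining' := fun g => LinearMap.ext fun w => ?_ }, fun v hv => ?_, fun i w => ?_,
    fun c j k hjk w => ?_⟩
  · have h1 := e.isIntertwining _ _ g v
    change DirectSum.component ℂ _ _ i (e (π g v)) = _
    refine (congrArg _ h1).trans ?_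
    simp [DirectSum.component, DirectSum.lmap]
    rfl
  · have h1 := e.symm.isIntertwining _ _ g 
      (DirectSum.lof ℂ _ (fun i : quotientSet π × Fin m => (i.1 : Irr H).out.V) i w)
    refine Eq.trans ?_ h1
    change e.symm _ = e.symm _
    congr 1
    simp
  · apply e.injective
    rw [map_zero]
    ext i
    exact hv i
  · change DirectSum.component ℂ _ _ i (e (e.symm _)) = w
    rw [Representation.Equiv.apply_symm_apply]
    exact DirectSum.component.lof_self ℂ (M := fun i : quotientSet π × Fin m => (i.1 : Irr H).out.V)
      i w
  · change DirectSum.component ℂ _ _ (c, j) (e (e.symm _)) = 0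
    rw [Representation.Equiv.apply_symm_apply]
    refine (DirectSum.component.of ℂ _ _ _).trans (dif_neg ?_)
    simpa using Ne.symm hjk

variable {V V₁ V₂ : Type*} [AddCommGroup V] [Module ℂ V] [AddCommGroup V₁] [Module ℂ V₁]
  [AddCommGroup V₂] [Module ℂ V₂]

/-- If the second factor is irreducible under operators that act compatibly on the source of `F`,
then no nonzero linear map of the second factor kills the image of `F`. -/
theorem eq_zero_of_forall_lTensor_comp_eq_zero {G X : Type*} [Group G]
    [AddCommGroup X] [Module ℂ X] {π : Representation ℂ G V₂} (hπ : π.IsIrreducible)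
    {F : V →ₗ[ℂ] V₁ ⊗[ℂ] V₂} (hF : F ≠ 0)
    (hst : ∀ g : G, ∃ (T : V → V) (S : V₁ →ₗ[ℂ] V₁),
      ∀ v, (π g).lTensor V₁ (F v) = S.rTensor V₂ (F (T v)))
    {φ : V₂ →ₗ[ℂ] X} (h : ∀ v, φ.lTensor V₁ (F v) = 0) : φ = 0 := by
  -- The span of the contractions of the image of `F`. It is killed by `φ`, and it is stable under
  -- `G` because the operator `S` on the first leg can be absorbed into the linear form.
  let D : Submodule ℂ V₂ :=
    Submodule.span ℂ {x | ∃ (l : V₁ →ₗ[ℂ] ℂ) (v : V), x = TensorProduct.lid ℂ V₂ (l.rTensor V₂ (F v))}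
  have hD : D ≤ LinearMap.ker φ := by
    rw [Submodule.span_le]
    rintro _ ⟨l, v, rfl⟩
    have key : φ ∘ₗ (TensorProduct.lid ℂ V₂).toLinearMap ∘ₗ l.rTensor V₂
        = (TensorProduct.lid ℂ X).toLinearMap ∘ₗ l.rTensor X ∘ₗ φ.lTensor V₁ := by
      ext v w
      simp
    rw [SetLike.mem_coe, LinearMap.mem_ker]
    simpa only [LinearMap.comp_apply, LinearEquiv.coe_coe, h v, map_zero]
      using LinearMap.congr_fun key (F v)
  rcases hπ.eq_bot_or_eq_top_of_stable D fun g x hx => by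
    induction hx using Submodule.span_induction with
    | mem x hx =>
      obtain ⟨l, v, rfl⟩ := hx
      obtain ⟨T, S, hTS⟩ := hst g
      refine Submodule.subset_span ⟨l ∘ₗ S, T v, ?_⟩
      have key : π g ∘ₗ (TensorProduct.lid ℂ V₂).toLinearMap ∘ₗ l.rTensor V₂
          = (TensorProduct.lid ℂ V₂).toLinearMap ∘ₗ l.rTensor V₂ ∘ₗ (π g).lTensor V₁ := by
        ext v w
        simp
      have h1 := LinearMap.congr_fun key (F v)
      simp only [LinearMap.comp_apply, LinearEquiv.coe_coe, hTS v] at h1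
      rw [h1, LinearMap.rTensor_comp, LinearMap.comp_apply]
    | zero => simp
    | add x y _ _ hx hy => rw [map_add]; exact D.add_mem hx hy
    | smul c x _ hx => rw [map_smul]; exact D.smul_mem c hx with hbot | htop
  · refine absurd (LinearMap.ext fun v => ?_) hF
    refine TensorProduct.eq_zero_of_forall_contract_left _ fun l => ?_
    have : TensorProduct.lid ℂ V₂ (l.rTensor V₂ (F v)) ∈ D := Submodule.subset_span ⟨l, v, rfl⟩
    rw [hbot] at this
    exact this
  · exact LinearMap.ext fun x => hD (htop ▸ trivial : x ∈ D)

/-- The components of (1 ⊗ φ)F along the first factor vanish except at i₀. A dependence there is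
thus one between (1 ⊗ φ)F and (1 ⊗ φ')F, which descends to φ and φ' by `hF`. -/
theorem exists_dependence_of_map_comp_eq_zero {I X : Type*} {S : I → Type*}
    [∀ i, AddCommGroup (S i)] [∀ i, Module ℂ (S i)] [AddCommGroup X] [Module ℂ X]
    {F : V →ₗ[ℂ] V₁ ⊗[ℂ] V₂}
    (hF : ∀ φ : V₂ →ₗ[ℂ] X, (∀ v, φ.lTensor V₁ (F v) = 0) → φ = 0)
    (p : ∀ i, V₁ →ₗ[ℂ] S i) (hp : ∀ v, (∀ i, p i v = 0) → v = 0) (φ φ' : V₂ →ₗ[ℂ] X) (i₀ : I)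
    (h : ∀ i ≠ i₀, ∀ v, TensorProduct.map (p i) φ (F v) = 0)
    (h' : ∀ i ≠ i₀, ∀ v, TensorProduct.map (p i) φ' (F v) = 0)
    (h₀ : ∃ a b : ℂ, (a ≠ 0 ∨ b ≠ 0) ∧ ∀ v,
      a • TensorProduct.map (p i₀) φ (F v) + b • TensorProduct.map (p i₀) φ' (F v) = 0) :
    ∃ a b : ℂ, (a ≠ 0 ∨ b ≠ 0) ∧ a • φ + b • φ' = 0 := by
  obtain ⟨a, b, hab, h₀⟩ := h₀
  refine ⟨a, b, hab, hF _ fun v => TensorProduct.eq_zero_of_forall_rTensor p hp _ fun i => ?_⟩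
  rw [← LinearMap.comp_apply, LinearMap.rTensor_comp_lTensor, TensorProduct.map_add_right,
    TensorProduct.map_smul_right, TensorProduct.map_smul_right]
  by_cases hi : i = i₀
  · subst hi
    exact h₀ v
  · simp [h i hi v, h' i hi v]

end Multiplicity

/-! ### Transfer of multiplicity one across a strong bigraph -/

section Bigraph

variable {A B : Type u} [Group A] [TopologicalSpace A] [Group B] [TopologicalSpace B]
  [IsTopologicalGroup A] [IsTopologicalGroup B]
  {V V₁ V₂ : Type*} [AddCommGroup V] [Module ℂ V] [AddCommGroup V₁] [Module ℂ V₁]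
  [AddCommGroup V₂] [Module ℂ V₂]
  {ρ : Representation ℂ (A × B) V} {π₁ : Representation ℂ A V₁} {π₂ : Representation ℂ B V₂}

theorem TensorProduct.comm_map_apply {M N M' N' : Type*} [AddCommGroup M] [Module ℂ M]
    [AddCommGroup N] [Module ℂ N] [AddCommGroup M'] [Module ℂ M'] [AddCommGroup N'] [Module ℂ N']
    (f : M →ₗ[ℂ] M') (g : N →ₗ[ℂ] N') (x : M ⊗[ℂ] N) :
    TensorProduct.map g f (TensorProduct.comm ℂ M N x)
      = TensorProduct.comm ℂ M' N' (TensorProduct.map f g x) := by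
  induction x with
  | zero => simp
  | add x y hx hy => simp [hx, hy]
  | tmul v w => simp

/-- Trades an operator on the second factor alone for the simultaneous action of an element of Γ,
corrected on the first factor. -/
theorem TensorProduct.lTensor_eq_rTensor_map {M N : Type*} [AddCommGroup M] [Module ℂ M]
    [AddCommGroup N] [Module ℂ N] {S S' : M →ₗ[ℂ] M} (h : ∀ m, S (S' m) = m) (R : N →ₗ[ℂ] N)
    (x : M ⊗[ℂ] N) : R.lTensor M x = S.rTensor N (TensorProduct.map S' R x) := by
  induction x with
  | zero => simp
  | add x y hx hy => simp only [map_add, hx, hy]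
  | tmul v w => simp [h]

/-- The projections to two distinct copies of `d` would be independent, as evaluation on the two
sections shows. -/
theorem IsSumWithMultiplicity.le_one_of_dependent {H : Type u} {W : Type*} [Group H]
    [TopologicalSpace H] [AddCommGroup W] [Module ℂ W] {π : Representation ℂ H W} {m : ℕ}
    (h : IsSumWithMultiplicity π m) (d : quotientSet π)
    (hdep : ∀ φ φ' : Representation.IntertwiningMap π (d : Irr H).out.rep,
      ∃ a b : ℂ, (a ≠ 0 ∨ b ≠ 0) ∧ a • φ.toLinearMap + b • φ'.toLinearMap = 0) : m ≤ 1 := by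
  by_contra! hm
  obtain ⟨p, ι, -, hself, hne⟩ := h.exists_projections
  let j : Fin m := ⟨0, by omega⟩
  let k : Fin m := ⟨1, hm⟩
  have hjk : j ≠ k := by simp [j, k]
  obtain ⟨a, b, hab, h0⟩ := hdep (p (d, j)) (p (d, k))
  have := (d : Irr H).out.irreducible.nontrivial_space
  obtain ⟨w, hw⟩ := exists_ne (0 : (d : Irr H).out.V)
  have h1 : a • p (d, j) (ι (d, j) w) + b • p (d, k) (ι (d, j) w) = 0 :=
    LinearMap.congr_fun h0 (ι (d, j) w)
  have h2 : a • p (d, j) (ι (d, k) w) + b • p (d, k) (ι (d, k) w) = 0 :=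
    LinearMap.congr_fun h0 (ι (d, k) w)
  rw [hself (d, j) w, hne d k j hjk.symm, smul_zero, add_zero, smul_eq_zero_iff_left hw] at h1
  rw [hself (d, k) w, hne d j k hjk, smul_zero, zero_add, smul_eq_zero_iff_left hw] at h2
  exact hab.elim (fun h => h h1) fun h => h h2

/-- A nonzero component of (1 ⊗ φ)F at a constituent c' makes c' ⊗ d a quotient of ρ, so by `hc`
only c contributes. With a single copy of c, that component lies in a Hom space of dimension at most
1. -/
theorem IsStrongBigraphRep.multiplicity_snd_le_one (hρ : IsStrongBigraphRep ρ)
    (hadm : ∀ σ : SmoothIrrep A, IsAdmissibleRep σ.rep)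
    (F : Representation.IntertwiningMap ρ (extTensor π₁ π₂)) {m : ℕ}
    (hm₁ : IsSumWithMultiplicity π₁ 1) (hm₂ : IsSumWithMultiplicity π₂ m)
    (c : quotientSet π₁) (d : quotientSet π₂)
    (hF : ∀ φ : V₂ →ₗ[ℂ] (d : Irr B).out.V, (∀ v, φ.lTensor V₁ (F v) = 0) → φ = 0)
    (hc : ∀ c' : quotientSet π₁, TensorMemQuotientSet ρ (c' : Irr A) (d : Irr B) → c' = c) :
    m ≤ 1 := by
  obtain ⟨p, -, hp, -, -⟩ := hm₁.exists_projections
  have hvan : ∀ (φ : Representation.IntertwiningMap π₂ (d : Irr B).out.rep),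
      ∀ i ≠ (c, 0), ∀ v, TensorProduct.map (p i).toLinearMap φ.toLinearMap (F v) = 0 := by
    intro φ i hi v
    by_contra hv
    refine hi (Prod.ext (hc i.1 ?_) (Subsingleton.elim _ _))
    rw [← Irr.toIrr_out (i.1 : Irr A), ← Irr.toIrr_out (d : Irr B)]
    exact tensorMemQuotientSet_of_ne_zero (hadm _) (f := (extTensorMap (p i) φ).comp F)
      fun h => hv (DFunLike.congr_fun h v)
  refine hm₂.le_one_of_dependent d fun φ φ' => ?_
  refine exists_dependence_of_map_comp_eq_zero (F := F.toLinearMap) hF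
    (fun i => (p i).toLinearMap) hp φ.toLinearMap φ'.toLinearMap (c, 0) (hvan φ) (hvan φ') ?_
  obtain ⟨a, b, hab, h⟩ := hρ.exists_smul_add_smul_eq_zero (hadm (c : Irr A).out)
    ((extTensorMap (p (c, 0)) φ).comp F) ((extTensorMap (p (c, 0)) φ').comp F)
  exact ⟨a, b, hab, fun v => DFunLike.congr_fun h v⟩

theorem IsStrongBigraphRep.multiplicity_fst_le_one (hρ : IsStrongBigraphRep ρ)
    (hadm : ∀ σ : SmoothIrrep A, IsAdmissibleRep σ.rep)
    (F : Representation.IntertwiningMap ρ (extTensor π₁ π₂)) {m : ℕ}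
    (hm₁ : IsSumWithMultiplicity π₁ m) (hm₂ : IsSumWithMultiplicity π₂ 1)
    (c : quotientSet π₁) (d : quotientSet π₂)
    (hF : ∀ φ : V₁ →ₗ[ℂ] (c : Irr A).out.V,
      (∀ v, φ.lTensor V₂ (TensorProduct.comm ℂ V₁ V₂ (F v)) = 0) → φ = 0)
    (hd : ∀ d' : quotientSet π₂, TensorMemQuotientSet ρ (c : Irr A) (d' : Irr B) → d' = d) :
    m ≤ 1 := by
  obtain ⟨p, -, hp, -, -⟩ := hm₂.exists_projections
  have hvan : ∀ (φ : Representation.IntertwiningMap π₁ (c : Irr A).out.rep),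
      ∀ i ≠ (d, 0), ∀ v, TensorProduct.map (p i).toLinearMap φ.toLinearMap
        (TensorProduct.comm ℂ V₁ V₂ (F v)) = 0 := by
    intro φ i hi v
    rw [TensorProduct.comm_map_apply, LinearEquiv.map_eq_zero_iff]
    by_contra hv
    refine hi (Prod.ext (hd i.1 ?_) (Subsingleton.elim _ _))
    rw [← Irr.toIrr_out (i.1 : Irr B), ← Irr.toIrr_out (c : Irr A)]
    exact tensorMemQuotientSet_of_ne_zero (hadm _) (f := (extTensorMap φ (p i)).comp F)
      fun h => hv (DFunLike.congr_fun h v)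
  refine hm₁.le_one_of_dependent c fun φ φ' => ?_
  refine exists_dependence_of_map_comp_eq_zero
    (F := (TensorProduct.comm ℂ V₁ V₂).toLinearMap ∘ₗ F.toLinearMap) hF
    (fun i => (p i).toLinearMap) hp φ.toLinearMap φ'.toLinearMap (d, 0) (hvan φ) (hvan φ') ?_
  obtain ⟨a, b, hab, h⟩ := hρ.exists_smul_add_smul_eq_zero (hadm (c : Irr A).out)
    ((extTensorMap φ (p (d, 0))).comp F) ((extTensorMap φ' (p (d, 0))).comp F)
  refine ⟨a, b, hab, fun v => ?_⟩
  have h1 := congrArg (TensorProduct.comm ℂ (c : Irr A).out.V (d : Irr B).out.V)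
    (DFunLike.congr_fun h v)
  have h2 := fun φ : Representation.IntertwiningMap π₁ (c : Irr A).out.rep =>
    TensorProduct.comm_map_apply φ.toLinearMap (p (d, 0)).toLinearMap (F v)
  change a • TensorProduct.map _ _ (TensorProduct.comm ℂ V₁ V₂ (F v)) +
    b • TensorProduct.map _ _ (TensorProduct.comm ℂ V₁ V₂ (F v)) = 0
  have h3 : ∀ x y : (c : Irr A).out.V ⊗[ℂ] (d : Irr B).out.V,
      TensorProduct.comm ℂ _ _ (a • x + b • y) =
        a • TensorProduct.comm ℂ _ _ x + b • TensorProduct.comm ℂ _ _ y := fun x y => by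
    rw [map_add, map_smul, map_smul]
  rw [h2, h2]
  exact (h3 _ _).symm.trans (h1.trans (map_zero _))

end Bigraph

/-! ### Twisting and admissibility along Γ -/

section Graph

variable {G₁ G₂ : Type u} [Group G₁] [TopologicalSpace G₁] [IsTopologicalGroup G₁]
  [Group G₂] [TopologicalSpace G₂] [IsTopologicalGroup G₂]
  {H₁ : Subgroup G₁} {H₂ : Subgroup G₂} {Γ : Subgroup (G₁ × G₂)} {hle : H₁.prod H₂ ≤ Γ}
  {V : Type*} [AddCommGroup V] [Module ℂ V] {ρ : Representation ℂ Γ V}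

omit [IsTopologicalGroup G₁] [IsTopologicalGroup G₂] in
theorem continuous_prodInclusion : Continuous (prodInclusion H₁ H₂ Γ hle) := by
  refine Continuous.subtype_mk (f := fun x : H₁ × H₂ => ((x.1 : G₁), (x.2 : G₂))) (by fun_prop) _

/-- Precompose a map ρ → σ ⊗ δ with ρ(g₁, g₂): the pair is twisted simultaneously by the two
coordinates. -/
theorem tensorMemQuotientSet_twist [H₁.Normal] [H₂.Normal]
    (hadm : ∀ σ : SmoothIrrep H₁, IsAdmissibleRep σ.rep) {σ : SmoothIrrep H₁} {δ : SmoothIrrep H₂}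
    (h : TensorMemQuotientSet (ρ.comp (prodInclusion H₁ H₂ Γ hle)) σ.toIrr δ.toIrr)
    {g₁ : G₁} {g₂ : G₂} (hg : (g₁, g₂) ∈ Γ) :
    TensorMemQuotientSet (ρ.comp (prodInclusion H₁ H₂ Γ hle)) (σ.twist g₁).toIrr
      (δ.twist g₂).toIrr := by
  obtain ⟨f, hf⟩ := h.exists_ne_zero
  have hcomm : ∀ (x : H₁ × H₂) (v : V), ρ ⟨_, hg⟩ (ρ (prodInclusion H₁ H₂ Γ hle x) v) =
      ρ (prodInclusion H₁ H₂ Γ hle (MulAut.conjNormal g₁ x.1, MulAut.conjNormal g₂ x.2))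
        (ρ ⟨_, hg⟩ v) := by
    intro x v
    simp only [← Module.End.mul_apply, ← map_mul]
    congr 2
    ext <;> simp [prodInclusion]
  let f' : Representation.IntertwiningMap (ρ.comp (prodInclusion H₁ H₂ Γ hle))
      (extTensor (σ.twist g₁).rep (δ.twist g₂).rep) :=
    { toLinearMap := f.toLinearMap ∘ₗ ρ ⟨_, hg⟩
      isIntertwining' := fun x => LinearMap.ext fun v => by
        refine (congrArg f (hcomm x v)).trans ?_
        exact f.isIntertwining _ _ (MulAut.conjNormal g₁ x.1, MulAut.conjNormal g₂ x.2) _ }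
  refine tensorMemQuotientSet_of_ne_zero (hadm _) (f := f') fun h0 =>
    hf (DFunLike.ext _ _ fun v => ?_)
  have h1 : f (ρ ⟨_, hg⟩ (ρ ⟨_, hg⟩⁻¹ v)) = 0 := DFunLike.congr_fun h0 (ρ ⟨_, hg⟩⁻¹ v)
  rwa [← Module.End.mul_apply, ← map_mul, mul_inv_cancel, map_one] at h1

omit [IsTopologicalGroup G₁] [IsTopologicalGroup G₂] in
-- An open subgroup of Γ contains a product of open subgroups of H₁ and H₂, for which finiteness is
-- already known.
theorem finiteDimensional_fixedVectors_extTensor_comp_subtype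
    (hle : H₁.prod H₂ ≤ Γ)
    {V₁ V₂ : Type*} [AddCommGroup V₁] [Module ℂ V₁] [AddCommGroup V₂] [Module ℂ V₂]
    {π₁ : Representation ℂ G₁ V₁} {π₂ : Representation ℂ G₂ V₂}
    (h₁ : IsAdmissibleRep (π₁.comp H₁.subtype)) (h₂ : IsAdmissibleRep (π₂.comp H₂.subtype))
    (L : Subgroup Γ) (hL : IsOpen (L : Set Γ)) :
    FiniteDimensional ℂ (fixedVectors ((extTensor π₁ π₂).comp Γ.subtype) L) := by
  let i := prodInclusion H₁ H₂ Γ hle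
  let K₁ : Subgroup H₁ := L.comap (i.comp (MonoidHom.inl H₁ H₂))
  let K₂ : Subgroup H₂ := L.comap (i.comp (MonoidHom.inr H₁ H₂))
  have hi : Continuous i := continuous_prodInclusion
  have hc₁ : Continuous fun h : H₁ => i (h, 1) := hi.comp (continuous_id.prodMk continuous_const)
  have hc₂ : Continuous fun h : H₂ => i (1, h) := hi.comp (continuous_const.prodMk continuous_id)
  have hK₁ : IsOpen (K₁ : Set H₁) := hL.preimage hc₁
  have hK₂ : IsOpen (K₂ : Set H₂) := hL.preimage hc₂
  have := extTensor_fixedVectors_finiteDimensional h₁ h₂ K₁ hK₁ K₂ hK₂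
  have hsub : fixedVectors ((extTensor π₁ π₂).comp Γ.subtype) L ≤ fixedVectors
      (extTensor (π₁.comp H₁.subtype) (π₂.comp H₂.subtype)) (K₁.prod K₂) := fun x hx k hk => by
    have hkL : i k ∈ L := by
      have := L.mul_mem (show i (k.1, 1) ∈ L from hk.1) (show i (1, k.2) ∈ L from hk.2)
      rwa [← map_mul, Prod.mk_mul_mk, mul_one, one_mul] at this
    exact hx (i k) hkL
  exact Submodule.finiteDimensional_of_le hsub

end Graph

/-! ### The bijection of constituents and the multiplicities -/

theorem proposition7p4
    {G₁ G₂ : Type u} {V : Type*}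
    [Group G₁] [TopologicalSpace G₁] [IsTopologicalGroup G₁]
    [LocallyCompactSpace G₁] [TotallyDisconnectedSpace G₁]
    [Group G₂] [TopologicalSpace G₂] [IsTopologicalGroup G₂]
    [LocallyCompactSpace G₂] [TotallyDisconnectedSpace G₂]
    (H₁ : Subgroup G₁) [H₁.Normal] (hH₁ : IsClosed (H₁ : Set G₁))
    (H₂ : Subgroup G₂) [H₂.Normal] (hH₂ : IsClosed (H₂ : Set G₂))
    (hsol₁ : Group.IsSolvable (G₁ ⧸ H₁)) (hsol₂ : Group.IsSolvable (G₂ ⧸ H₂))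
    -- every irreducible smooth representation of `Gᵢ` or `Hᵢ` is admissible, and those of `Gᵢ`
    -- remain admissible on restriction to `Hᵢ`
    (hG₁ : ∀ π : SmoothIrrep G₁, IsAdmissibleRep π.rep)
    (hG₂ : ∀ π : SmoothIrrep G₂, IsAdmissibleRep π.rep)
    (hadm₁ : ∀ σ : SmoothIrrep H₁, IsAdmissibleRep σ.rep)
    (hadm₂ : ∀ σ : SmoothIrrep H₂, IsAdmissibleRep σ.rep)
    (hres₁ : ∀ π : SmoothIrrep G₁, IsAdmissibleRep (π.rep.comp H₁.subtype))
    (hres₂ : ∀ π : SmoothIrrep G₂, IsAdmissibleRep (π.rep.comp H₂.subtype))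
    -- `Γ / (H₁ × H₂)` is the graph of a bijective morphism `γ`
    (Γ : Subgroup (G₁ × G₂)) [Γ.Normal] (hΓ : IsClosed (Γ : Set (G₁ × G₂)))
    (hle : H₁.prod H₂ ≤ Γ)
    (γ : G₁ ⧸ H₁ →* G₂ ⧸ H₂) (hγ : Function.Bijective γ)
    (hgraph : ∀ (g₁ : G₁) (g₂ : G₂), (g₁, g₂) ∈ Γ ↔ γ (g₁ : G₁ ⧸ H₁) = (g₂ : G₂ ⧸ H₂))
    -- `ρ` is a smooth representation of `Γ` whose restriction to `H₁ × H₂` is a strong bigraph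
    [AddCommGroup V] [Module ℂ V] (ρ : Representation ℂ Γ V) (hρ : IsSmoothRep ρ)
    (hbig : IsStrongBigraphRep (ρ.comp (prodInclusion H₁ H₂ Γ hle)))
    (π₁ : SmoothIrrep G₁) (π₂ : SmoothIrrep G₂) (m₁ m₂ : ℕ)
    (hm₁ : IsSumWithMultiplicity (π₁.rep.comp H₁.subtype) m₁)
    (hm₂ : IsSumWithMultiplicity (π₂.rep.comp H₂.subtype) m₂)
    (hπ : TensorMemQuotientSet (cInd Γ ρ) π₁.toIrr π₂.toIrr) :
    (∃ θ : quotientSet (π₁.rep.comp H₁.subtype) ≃ quotientSet (π₂.rep.comp H₂.subtype),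
      ∀ (s : quotientSet (π₁.rep.comp H₁.subtype)) (d : quotientSet (π₂.rep.comp H₂.subtype)),
        TensorMemQuotientSet (ρ.comp (prodInclusion H₁ H₂ Γ hle)) (s : Irr H₁) (d : Irr H₂) ↔
          d = θ s) ∧
    (m₁ = 1 ↔ m₂ = 1) := by
  obtain ⟨Φ, hΦ⟩ := hπ.exists_ne_zero
  obtain ⟨K₀, hK₀, hK₀c, -⟩ :=
    exists_isOpen_isCompact_subgroup (G := G₁ × G₂) Filter.univ_mem
  obtain ⟨F, hF⟩ := exists_intertwiningMap_ne_zero_of_cInd hρ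
    (extTensor_isSmooth π₁.smooth π₂.smooth)
    (finiteDimensional_fixedVectors_extTensor_comp_subtype hle (hres₁ π₁) (hres₂ π₂))
    (fun U hU => by
      obtain ⟨K, hK, -, hKU⟩ := exists_isOpen_isCompact_subgroup hU
      exact ⟨K, hK, hKU⟩) hK₀ hK₀c hΦ
  set ρH := ρ.comp (prodInclusion H₁ H₂ Γ hle)
  let FH : Representation.IntertwiningMap ρH
      (extTensor (π₁.rep.comp H₁.subtype) (π₂.rep.comp H₂.subtype)) :=
    { toLinearMap := F.toLinearMap
      isIntertwining' := fun x => F.isIntertwining' (prodInclusion H₁ H₂ Γ hle x) }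
  have hex₂ : ∀ g₁ : G₁, ∃ g₂ : G₂, (g₁, g₂) ∈ Γ := fun g₁ => by
    obtain ⟨g₂, hg₂⟩ := QuotientGroup.mk_surjective (γ (g₁ : G₁ ⧸ H₁))
    exact ⟨g₂, (hgraph g₁ g₂).2 hg₂.symm⟩
  have hex₁ : ∀ g₂ : G₂, ∃ g₁ : G₁, (g₁, g₂) ∈ Γ := fun g₂ => by
    obtain ⟨x, hx⟩ := hγ.2 (g₂ : G₂ ⧸ H₂)
    obtain ⟨g₁, rfl⟩ := QuotientGroup.mk_surjective x
    exact ⟨g₁, (hgraph g₁ g₂).2 hx⟩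
  have hFΓ : ∀ (g : Γ) v, F (ρ g v) =
      TensorProduct.map (π₁.rep g.1.1) (π₂.rep g.1.2) (F v) := fun g v => F.isIntertwining _ _ g v
  -- Each g₂ lifts to some (g₁, g₂) in Γ. Equivariance of `F`, followed by π₁(g₁)⁻¹ on the first
  -- leg, supplies the compatible operators.
  have hF₂ : ∀ (d : Irr H₂) (φ : π₂.V →ₗ[ℂ] d.out.V),
      (∀ v, φ.lTensor π₁.V (F v) = 0) → φ = 0 := by
    intro d φ
    refine eq_zero_of_forall_lTensor_comp_eq_zero (F := F.toLinearMap) π₂.irreducible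
      (fun h => hF (Representation.IntertwiningMap.ext h)) fun g₂ => ?_
    obtain ⟨g₁, hg⟩ := hex₁ g₂
    refine ⟨ρ ⟨_, hg⟩, π₁.rep g₁⁻¹, fun v => ?_⟩
    change _ = (π₁.rep g₁⁻¹).rTensor π₂.V (F (ρ ⟨_, hg⟩ v))
    rw [hFΓ]
    exact TensorProduct.lTensor_eq_rTensor_map (fun m => π₁.rep.inv_self_apply g₁ m) _ _
  have hF₁ : ∀ (c : Irr H₁) (φ : π₁.V →ₗ[ℂ] c.out.V),
      (∀ v, φ.lTensor π₂.V (TensorProduct.comm ℂ π₁.V π₂.V (F v)) = 0) → φ = 0 := by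
    intro c φ
    refine eq_zero_of_forall_lTensor_comp_eq_zero
      (F := (TensorProduct.comm ℂ π₁.V π₂.V).toLinearMap ∘ₗ F.toLinearMap) π₁.irreducible
      (fun h => hF (Representation.IntertwiningMap.ext (LinearMap.ext fun v =>
        (TensorProduct.comm ℂ π₁.V π₂.V).injective ((LinearMap.congr_fun h v).trans
          (map_zero _).symm)))) fun g₁ => ?_
    obtain ⟨g₂, hg⟩ := hex₂ g₁
    refine ⟨ρ ⟨_, hg⟩, π₂.rep g₂⁻¹, fun v => ?_⟩
    change _ = (π₂.rep g₂⁻¹).rTensor π₁.V (TensorProduct.comm ℂ π₁.V π₂.V (F (ρ ⟨_, hg⟩ v)))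
    rw [hFΓ, ← TensorProduct.comm_map_apply]
    exact TensorProduct.lTensor_eq_rTensor_map (fun m => π₂.rep.inv_self_apply g₂ m) _ _
  obtain ⟨p₁, ι₁, hp₁, hι₁, -⟩ := hm₁.exists_projections
  obtain ⟨p₂, ι₂, hp₂, hι₂, -⟩ := hm₂.exists_projections
  -- A first matched pair, from which twisting by Γ reaches all the others.
  obtain ⟨⟨c₀, j₀⟩, ⟨d₀, k₀⟩, v₀, hv₀⟩ : ∃ i j v,
      TensorProduct.map (p₁ i).toLinearMap (p₂ j).toLinearMap (F v) ≠ 0 := by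
    by_contra! h
    refine hF (DFunLike.ext _ _ fun v => ?_)
    exact TensorProduct.eq_zero_of_forall_map (fun i => (p₁ i).toLinearMap) hp₁
      (fun j => (p₂ j).toLinearMap) hp₂ _ fun i j => h i j v
  have h₀ : TensorMemQuotientSet ρH (c₀ : Irr H₁).out.toIrr (d₀ : Irr H₂).out.toIrr :=
    tensorMemQuotientSet_of_ne_zero (hadm₁ _)
      (f := (extTensorMap (p₁ (c₀, j₀)) (p₂ (d₀, k₀))).comp FH)
      fun h => hv₀ (DFunLike.congr_fun h v₀)
  have hι₁0 : ∀ c, ι₁ (c, j₀) ≠ 0 := fun c h => by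
    have := (c : Irr H₁).out.irreducible.nontrivial_space
    obtain ⟨w, hw⟩ := exists_ne (0 : (c : Irr H₁).out.V)
    exact hw (by rw [← hι₁ (c, j₀) w, h]; exact map_zero _)
  have hι₂0 : ∀ d, ι₂ (d, k₀) ≠ 0 := fun d h => by
    have := (d : Irr H₂).out.irreducible.nontrivial_space
    obtain ⟨w, hw⟩ := exists_ne (0 : (d : Irr H₂).out.V)
    exact hw (by rw [← hι₂ (d, k₀) w, h]; exact map_zero _)
  have hc₀ : (c₀ : Irr H₁).out.toIrr ∈ quotientSet (π₁.rep.comp H₁.subtype) := by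
    rw [Irr.toIrr_out]; exact c₀.2
  have hd₀ : (d₀ : Irr H₂).out.toIrr ∈ quotientSet (π₂.rep.comp H₂.subtype) := by
    rw [Irr.toIrr_out]; exact d₀.2
  have hR₁ : ∀ c : quotientSet (π₁.rep.comp H₁.subtype),
      ∃ d : quotientSet (π₂.rep.comp H₂.subtype),
        TensorMemQuotientSet ρH (c : Irr H₁) (d : Irr H₂) := by
    intro c
    obtain ⟨g₁, hg₁⟩ := exists_twist_equiv π₁.irreducible hc₀ (hι₁0 c)
    obtain ⟨g₂, hg⟩ := hex₂ g₁
    refine ⟨⟨_, twist_mem_quotientSet hd₀ g₂⟩, ?_⟩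
    have := tensorMemQuotientSet_twist hadm₁ h₀ hg
    rwa [hg₁, Irr.toIrr_out] at this
  have hR₂ : ∀ d : quotientSet (π₂.rep.comp H₂.subtype),
      ∃ c : quotientSet (π₁.rep.comp H₁.subtype),
        TensorMemQuotientSet ρH (c : Irr H₁) (d : Irr H₂) := by
    intro d
    obtain ⟨g₂, hg₂⟩ := exists_twist_equiv π₂.irreducible hd₀ (hι₂0 d)
    obtain ⟨g₁, hg⟩ := hex₁ g₂
    refine ⟨⟨_, twist_mem_quotientSet hc₀ g₁⟩, ?_⟩
    have := tensorMemQuotientSet_twist hadm₁ h₀ hg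
    rwa [hg₂, Irr.toIrr_out] at this
  choose θ hθ using hR₁
  have hθu : ∀ (c : quotientSet (π₁.rep.comp H₁.subtype))
      (d : quotientSet (π₂.rep.comp H₂.subtype)), TensorMemQuotientSet ρH (c : Irr H₁) (d : Irr H₂) ↔ d = θ c := fun c d =>
    ⟨fun h => Subtype.ext (hbig.snd_unique h (hθ c)), fun h => h ▸ hθ c⟩
  have hθb : Function.Bijective θ := by
    refine ⟨fun c c' h => Subtype.ext (hbig.fst_unique (hθ c) (h ▸ hθ c')), fun d => ?_⟩
    obtain ⟨c, hc⟩ := hR₂ d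
    exact ⟨c, ((hθu c d).1 hc).symm⟩
  refine ⟨⟨Equiv.ofBijective θ hθb, hθu⟩, ?_, ?_⟩
  · rintro rfl
    -- The lower bound on m₂ holds because `k₀` is an element of `Fin m₂`.
    refine le_antisymm (hbig.multiplicity_snd_le_one hadm₁ FH hm₁ hm₂ c₀ (θ c₀) (hF₂ _) ?_)
      (Nat.succ_le_of_lt k₀.pos)
    exact fun c' h => hθb.1 ((hθu c' _).1 h).symm
  · rintro rfl
    refine le_antisymm (hbig.multiplicity_fst_le_one hadm₁ FH hm₁ hm₂ c₀ (θ c₀) (hF₁ _) ?_)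
      (Nat.succ_le_of_lt j₀.pos)
    exact fun d' h => (hθu c₀ d').1 h
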